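/- Consider $m$ resources with initial inventory $c\in\mathbb N^m$ and $n$ products with prices $p\in\mathbb R^n$ and consumption matrix $A=[a_{ij}]\in\mathbb N^{m\times n}$ (selling one unit of product $j$ uses the column $A^j$); assume $A^j\neq 0$ for every $j$. Customers arrive in a Poisson process with rate $\lambda>0$; a customer who is offered $S\subseteq\{1,\dots,n\}$ chooses $j\in S\cup\{0\}$ with probability $P_j(S)$ ($0$ = no purchase; $P_j(S)=0$ for $j\notin S\cup\{0\}$). Let $T>0$, $\gamma\ge 0$, $\mathcal X=\prod_{i=1}^m\{0,\dots,c_i\}$, $\mathcal A(x)=\{S: x\ge A^j\ \forall j\in S\}$, $r(S)=\lambda\sum_{j=1}^n p_jP_j(S)$, $$q(y\mid t,x,S)=\sum_{j:\,A^j=x-y}\lambda P_j(S)\ (y\ne x),\qquad q(x\mid t,x,S)=-\lambda[1-P_0(S)],$$ $$H(t,x,S,v)=r(S)+\sum_{y\in\mathcal X}v(t,y)\,q(y\mid t,x,S).$$ Let $\pi$ be an admissible randomized Markov policy: for each $(t,x)\in[0,T]\times\mathcal X$, $\pi(\cdot\mid t,x)$ is a probability distribution on the assortments with $\pi(S\mid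 t,x)=0$ for $S\notin\mathcal A(x)$, and $t\mapsto\pi(S\mid t,x)$ is continuous on $[0,T]$. Put $\mathcal H(\pi(\cdot\mid t,x))=-\sum_{S\in\mathcal A(x)}\pi(S\mid t,x)\log\pi(S\mid t,x)$ (with $0\log 0=0$). Under $\pi$, a customer who arrives at time $s$ is offered an assortment drawn from $\pi(\cdot\mid s,X_{s-})$; $N_s\in\mathbb N^n$ counts the products sold, $X$ is the remaining inventory (each sale of product $j$ lowers it by $A^j$), and $$J(t,x;\pi)=\mathbb E\Big[\int_{(t,T]}p^\top dN_s+\gamma\int_t^T\mathcal H(\pi(\cdot\mid s,X_{s-}))\,ds\ \Big|\ X_t=x\Big],$$ where conditioning on $X_t=x$ means that the Markov process is started in state $x$ at time $t$. Let $C^{1,0}([0,T]\times\mathcal X)$ be the set of functions $v:[0,T]\times\mathcal X\to\mathbb R$ such that $v(\cdot,x)$ is continuously differentiable on $[0,T]$ for every $x\in\mathcal X$ (one-sided derivatives at the endpoints). Then a function $v\in C^{1,0}([0,T]\times\mathcal X)$ satisfies $v(t,x)=J(t,x;\pi)$ for all $(t,x)\in[0,T]\times\mathcal X$ if and only if $$\frac{\partial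 v}{\partial t}(t,x)+\sum_{S\in\mathcal A(x)}H(t,x,S,v)\,\pi(S\mid t,x)+\gamma\,\mathcal H(\pi(\cdot\mid t,x))=0,\qquad (t,x)\in[0,T)\times\mathcal X,$$ and $v(T,x)=0$ for all $x\in\mathcal X$. Moreover, a solution $v\in C^{1,0}([0,T]\times\mathcal X)$ of this terminal value problem exists. -/

import Mathlib

open MeasureTheory ProbabilityTheory Set
open scoped Matrix unitInterval

noncomputable section

namespace RevenueManagement

/-- The primitives of the choice-based network revenue management problem with `m` resources and
`n` products. In the choice probabilities, `none` is the no-purchase option. -/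
structure Model (m n : ℕ) where
  /-- consumption matrix: selling one unit of product `j` uses `A i j` units of resource `i` -/
  A : Matrix (Fin m) (Fin n) ℕ
  /-- initial inventory -/
  c : Fin m → ℕ
  /-- prices -/
  p : Fin n → ℝ
  /-- customer arrival rate -/
  lam : ℝ
  lam_pos : 0 < lam
  /-- `P S j` is the probability that a customer who is offered `S` chooses `j` -/
  P : Finset (Fin n) → Option (Fin n) → ℝ
  P_nonneg : ∀ S j, 0 ≤ P S j
  P_eq_zero : ∀ S j, j ∉ S → P S (some j) = 0
  P_sum : ∀ S, ∑ j, P S j = 1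

/-- Inverse transform sampling: if `w` is a probability vector on the finite type `α` and `u` is
uniform on `[0, 1]`, then `sample w u` has distribution `w` (the points of `α` are listed in a
fixed order; `default` only occurs on the null set `u = 1`). -/
def sample {α : Type} [Fintype α] [Inhabited α] (w : α → ℝ) (u : I) : α :=
  open Classical in
  if h : ∃ a : α,
      ∑ b with Fintype.equivFin α b < Fintype.equivFin α a, w b ≤ (u : ℝ) ∧
        (u : ℝ) < ∑ b with Fintype.equivFin α b ≤ Fintype.equivFin α a, w b
  then h.choose else default

namespace Model

variable {m n : ℕ} (M : Model m n)

/-- The state space `{0, …, c₁} × ⋯ × {0, …, cₘ}` of inventory levels. -/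
abbrev State : Type := ↥(Set.Iic M.c)

/-- `𝒜(x)`: the assortments all of whose products can be sold in state `x`. -/
def feasible (x : M.State) : Finset (Finset (Fin n)) :=
  Finset.univ.filter fun S => ∀ j ∈ S, ∀ i, M.A i j ≤ x.1 i

/-- Expected revenue rate `r(S)` of an assortment. -/
def r (S : Finset (Fin n)) : ℝ := M.lam * ∑ j, M.p j * M.P S (some j)

/-- Controlled transition rates `q(y ∣ t, x, S)` (they do not depend on `t`). The condition
`y + A^j = x` is `A^j = x - y`. -/
def q (y x : M.State) (S : Finset (Fin n)) : ℝ :=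
  if y = x then -(M.lam * (1 - M.P S none))
  else ∑ j with (∀ i, y.1 i + M.A i j = x.1 i), M.lam * M.P S (some j)

/-- The Hamiltonian `H(t, x, S, v)`. -/
def hamiltonian (t : ℝ) (x : M.State) (S : Finset (Fin n)) (v : ℝ → M.State → ℝ) : ℝ :=
  M.r S + ∑ y, v t y * M.q y x S

/-- Randomized Markov policies; `π t x S` is `π(S ∣ t, x)`. Only times in `[0, T]` matter. -/
structure IsRandomizedMarkovPolicy (T : ℝ) (π : ℝ → M.State → Finset (Fin n) → ℝ) : Prop where
  measurable : ∀ x S, Measurable fun t : Icc (0 : ℝ) T => π t x S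
  nonneg : ∀ t ∈ Icc (0 : ℝ) T, ∀ x S, 0 ≤ π t x S
  sum_eq_one : ∀ t ∈ Icc (0 : ℝ) T, ∀ x, ∑ S, π t x S = 1

/-- Admissible randomized Markov policies. -/
structure IsAdmissible (T : ℝ) (π : ℝ → M.State → Finset (Fin n) → ℝ) : Prop
    extends M.IsRandomizedMarkovPolicy T π where
  eq_zero : ∀ t ∈ Icc (0 : ℝ) T, ∀ x, ∀ S ∉ M.feasible x, π t x S = 0
  continuousOn : ∀ x S, ContinuousOn (fun t => π t x S) (Icc 0 T)

/-- The entropy of `π(· ∣ t, x)`. -/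
def entropy (π : ℝ → M.State → Finset (Fin n) → ℝ) (t : ℝ) (x : M.State) : ℝ :=
  -∑ S ∈ M.feasible x, π t x S * Real.log (π t x S)

/-! ### The controlled process

Each customer carries an interarrival time, a uniform variable from which the offered assortment
is sampled, and a uniform variable from which the choice of the customer is sampled. -/

/-- Sample space: the sequence of the data of the customers. -/
abbrev Path : Type := ℕ → ℝ × I × I

instance : IsProbabilityMeasure (expMeasure M.lam) := isProbabilityMeasure_expMeasure M.lam_pos

/-- The law of the data: everything is independent, the interarrival times are exponential with
rate `λ` (so that arrivals form a Poisson process), the other variables uniform on `[0, 1]`. -/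
def law : Measure Path :=
  Measure.infinitePi fun _ : ℕ =>
    (expMeasure M.lam).prod ((volume : Measure I).prod (volume : Measure I))

/-- Arrival time of customer `k = 0, 1, …` when the clock is started at time `t`. -/
def arrivalTime (t : ℝ) (ω : Path) (k : ℕ) : ℝ := t + ∑ i ∈ Finset.range (k + 1), (ω i).1

/-- Inventory `x - A N` that is left when the vector `N` of products has been sold. (Under an
admissible policy no more than `x` is ever used, almost surely, so nothing is truncated.) -/
def inventory (x : M.State) (N : Fin n → ℕ) : M.State :=
  ⟨x.1 - M.A *ᵥ N, le_trans (tsub_le_self : x.1 - M.A *ᵥ N ≤ x.1) x.2⟩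

/-- The product bought (`none`: no purchase) by a customer with data `d` who arrives at time `τ`
and finds inventory `x`: the assortment is drawn from `π(· ∣ τ, x)`, then the choice of the
customer from the choice probabilities. Sales end at time `T`. -/
def purchase (T : ℝ) (π : ℝ → M.State → Finset (Fin n) → ℝ) (τ : ℝ) (x : M.State)
    (d : ℝ × I × I) : Option (Fin n) :=
  open Classical in
  if τ ≤ T then sample (M.P (sample (π τ x) d.2.1)) d.2.2 else none

/-- Vector of the numbers of products sold to the first `k` customers, when the process is started
at time `t` with inventory `x`. -/
def salesAfter (T : ℝ) (π : ℝ → M.State → Finset (Fin n) → ℝ) (t : ℝ) (x : M.State)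
    (ω : Path) : ℕ → Fin n → ℕ
  | 0 => 0
  | k + 1 =>
    let N := salesAfter T π t x ω k
    N + (M.purchase T π (arrivalTime t ω k) (M.inventory x N) (ω k)).elim 0
      (fun j => Pi.single j 1)

/-- `N_s`: the numbers of products sold in `(t, s]`, when started at time `t` with inventory `x`. -/
def sales (T : ℝ) (π : ℝ → M.State → Finset (Fin n) → ℝ) (t : ℝ) (x : M.State) (ω : Path)
    (s : ℝ) : Fin n → ℕ :=
  M.salesAfter T π t x ω {k | arrivalTime t ω k ≤ s}.ncard

/-- `X_s = x - A N_s`. -/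
def state (T : ℝ) (π : ℝ → M.State → Finset (Fin n) → ℝ) (t : ℝ) (x : M.State) (ω : Path)
    (s : ℝ) : M.State :=
  M.inventory x (M.sales T π t x ω s)

/-- `X_{s-}`: the inventory left by the arrivals strictly before time `s`. -/
def leftState (T : ℝ) (π : ℝ → M.State → Finset (Fin n) → ℝ) (t : ℝ) (x : M.State) (ω : Path)
    (s : ℝ) : M.State :=
  M.inventory x (M.salesAfter T π t x ω {k | arrivalTime t ω k < s}.ncard)

/-- The entropy-regularized value function `J(t, x; π)`: the expectation, for the process that is
in state `x` at time `t`, of the revenue `∑ⱼ pⱼ (N_{j,T} - N_{j,t})` collected in `(t, T]` plus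
`γ` times the time integral of the entropy of the policy along the path. -/
def valueFunction (T γ : ℝ) (π : ℝ → M.State → Finset (Fin n) → ℝ) (t : ℝ) (x : M.State) : ℝ :=
  ∫ ω, ((∑ j, M.p j *
        ((M.sales T π t x ω T j : ℝ) - (M.sales T π t x ω t j : ℝ))) +
      γ * ∫ s in t..T, M.entropy π s (M.leftState T π t x ω s)) ∂M.law

/-- `v ∈ C^{1,0}([0, T] × 𝒳)`. -/
def IsC10 (T : ℝ) (v : ℝ → M.State → ℝ) : Prop :=
  ∀ x, ContDiffOn ℝ 1 (fun t => v t x) (Icc 0 T)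

/-- The linear backward system of differential equations on `[0, T)`, with zero terminal value. -/
def SolvesBackwardODE (T γ : ℝ) (π : ℝ → M.State → Finset (Fin n) → ℝ)
    (v : ℝ → M.State → ℝ) : Prop :=
  (∀ t ∈ Ico 0 T, ∀ x,
    derivWithin (fun s => v s x) (Icc 0 T) t +
      ∑ S ∈ M.feasible x, M.hamiltonian t x S v * π t x S + γ * M.entropy π t x = 0) ∧
  ∀ x, v T x = 0

end Model

end RevenueManagement

end

/-!
Under `π` the process jumps only at the arrivals, so it is described by the chain
`Z_k = (time of the k-th arrival, inventory just after it)`, and `Z_{k+1}` is a function of `Z_k` and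
of the data of the next customer, which are independent of `Z_k` (`map_recursion_prodMk`). The proof
is a verification argument along this chain.

Averaging the Hamiltonian over the policy gives `λ` times the expected gain (price plus change of
`v`) from one arrival (`sum_hamiltonian_mul`; this uses that no column of `A` is zero). Hence the
backward system says that, between arrivals, `v` plus the entropy reward accumulated so far decreases
at rate `λ` times the expected gain from an arrival. Since interarrival times are exponential with
rate `λ`, this drift is compensated exactly by the gain at the next arrival
(`integral_expMeasure_compensated`), so that one transition of the chain changes `v` by minus the
reward, on average (`integral_increment`). Summing over all customers, `v(t, x)` is the expected total
reward (`integral_tsum_stepReward`). The exchange of sum and expectation and the vanishing of the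
remainder both rest on the bound `(1 - exp (-λ T)) ^ k` for the probability that at least `k`
customers arrive before `T` (`measureReal_chain_fst_le`). Pathwise, the sum of the rewards over the
customers is the revenue plus the entropy integral in the definition of `J`
(`totalReward_eq_tsum`). So every solution of the backward system is `J`.

A solution exists because the system is linear with continuous coefficients
(`exists_terminal_value_solution`). It equals `J` on `[0, T]`; conversely, then, any `v` that equals
`J` on `[0, T]` agrees there with this solution, and so solves the system.
-/

noncomputable section

namespace RevenueManagement

/-! ### Inverse transform sampling -/

section Sample

variable {α : Type} [Fintype α]

/-- Total weight of the points listed strictly before `a`; inverse transform sampling returns `a`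
on the interval of length `w a` that starts here. -/
def weightBefore (w : α → ℝ) (a : α) : ℝ :=
  ∑ b with Fintype.equivFin α b < Fintype.equivFin α a, w b

lemma sum_le_eq_weightBefore_add (w : α → ℝ) (a : α) :
    ∑ b with Fintype.equivFin α b ≤ Fintype.equivFin α a, w b = weightBefore w a + w a := by
  classical
  have h : (Finset.univ.filter fun b => Fintype.equivFin α b ≤ Fintype.equivFin α a) =
      insert a (Finset.univ.filter fun b => Fintype.equivFin α b < Fintype.equivFin α a) := by
    ext b
    simp [le_iff_eq_or_lt]
  rw [h, Finset.sum_insert (by simp), weightBefore, add_comm]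

lemma weightBefore_nonneg {w : α → ℝ} (hw : ∀ a, 0 ≤ w a) (a : α) : 0 ≤ weightBefore w a :=
  Finset.sum_nonneg fun b _ => hw b

lemma weightBefore_add_le_sum {w : α → ℝ} (hw : ∀ a, 0 ≤ w a) (a : α) :
    weightBefore w a + w a ≤ ∑ b, w b := by
  rw [← sum_le_eq_weightBefore_add]
  exact Finset.sum_le_sum_of_subset_of_nonneg (Finset.subset_univ _) fun b _ _ => hw b

lemma weightBefore_add_le_of_lt {w : α → ℝ} (hw : ∀ a, 0 ≤ w a) {a b : α}
    (hab : Fintype.equivFin α a < Fintype.equivFin α b) :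
    weightBefore w a + w a ≤ weightBefore w b := by
  rw [← sum_le_eq_weightBefore_add]
  refine Finset.sum_le_sum_of_subset_of_nonneg (fun c hc => ?_) fun b _ _ => hw b
  simp only [Finset.mem_filter, Finset.mem_univ, true_and] at hc ⊢
  exact hc.trans_lt hab

lemma eq_of_mem_sampling_intervals {w : α → ℝ} (hw : ∀ a, 0 ≤ w a) {u : ℝ} {a b : α}
    (ha : weightBefore w a ≤ u ∧ u < weightBefore w a + w a)
    (hb : weightBefore w b ≤ u ∧ u < weightBefore w b + w b) : a = b := by
  rcases lt_trichotomy (Fintype.equivFin α a) (Fintype.equivFin α b) with h | h | h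
  · linarith [weightBefore_add_le_of_lt hw h]
  · exact (Fintype.equivFin α).injective h
  · linarith [weightBefore_add_le_of_lt hw h]

lemma exists_mem_sampling_interval {w : α → ℝ} {u : ℝ}
    (hu : 0 ≤ u) (hu' : u < ∑ a, w a) :
    ∃ a, weightBefore w a ≤ u ∧ u < weightBefore w a + w a := by
  classical
  by_contra! hcon
  -- without such an interval, no initial segment of the list has weight exceeding `u`
  have key : ∀ N : ℕ, ∑ b with (Fintype.equivFin α b : ℕ) < N, w b ≤ u := by
    intro N
    induction N with
    | zero => simpa using hu
    | succ N ih =>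
      by_cases hN : N < Fintype.card α
      · obtain ⟨a, ha⟩ := (Fintype.equivFin α).surjective ⟨N, hN⟩
        have h1 : weightBefore w a ≤ u := by
          refine le_trans (le_of_eq ?_) ih
          simp only [weightBefore, ha, Fin.lt_def]
        refine le_trans (le_of_eq ?_) (hcon a h1)
        rw [← sum_le_eq_weightBefore_add]
        simp only [ha, Fin.le_def, Nat.lt_succ_iff]
      · refine le_trans (le_of_eq ?_) ih
        congr 1
        ext b
        have := (Fintype.equivFin α b).2
        simp only [Finset.mem_filter, Finset.mem_univ, true_and]
        omega
  have := key (Fintype.card α)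
  simp only [Fin.is_lt, Finset.filter_true] at this
  linarith

variable [Inhabited α]

lemma sample_eq_of_mem {w : α → ℝ} (hw : ∀ a, 0 ≤ w a) {u : I} {a : α}
    (ha : weightBefore w a ≤ u ∧ (u : ℝ) < weightBefore w a + w a) : sample w u = a := by
  have h : ∃ a : α,
      ∑ b with Fintype.equivFin α b < Fintype.equivFin α a, w b ≤ (u : ℝ) ∧
        (u : ℝ) < ∑ b with Fintype.equivFin α b ≤ Fintype.equivFin α a, w b :=
    ⟨a, ha.1, by rw [sum_le_eq_weightBefore_add]; exact ha.2⟩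
  rw [sample, dif_pos h]
  refine eq_of_mem_sampling_intervals hw ⟨h.choose_spec.1, ?_⟩ ha
  rw [← sum_le_eq_weightBefore_add]
  exact h.choose_spec.2

lemma sample_eq_iff {w : α → ℝ} (hw : ∀ a, 0 ≤ w a) (u : I) (a : α) :
    sample w u = a ↔ (weightBefore w a ≤ u ∧ (u : ℝ) < weightBefore w a + w a) ∨
      (a = default ∧ ∀ b, ¬ (weightBefore w b ≤ u ∧ (u : ℝ) < weightBefore w b + w b)) := by
  by_cases h : ∃ b, weightBefore w b ≤ u ∧ (u : ℝ) < weightBefore w b + w b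
  · obtain ⟨b, hb⟩ := h
    constructor
    · intro hs
      rw [sample_eq_of_mem hw hb] at hs
      exact Or.inl (hs ▸ hb)
    · rintro (ha | ⟨-, ha⟩)
      · exact sample_eq_of_mem hw ha
      · exact absurd hb (ha b)
  · have hs : sample w u = default := by
      rw [sample, dif_neg]
      simp only [sum_le_eq_weightBefore_add]
      exact h
    push Not at h
    rw [hs]
    constructor
    · rintro rfl
      exact Or.inr ⟨rfl, fun b hb => absurd hb.2 (not_lt.2 (h b hb.1))⟩
    · rintro (ha | ⟨ha, -⟩)
      · exact absurd ha.2 (not_lt.2 (h a ha.1))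
      · exact ha.symm

lemma measurable_comp_sample {β δ : Type*} [MeasurableSpace β] [MeasurableSpace δ]
    {w : β → α → ℝ} (hw : ∀ b a, 0 ≤ w b a) (hm : ∀ a, Measurable fun b => w b a)
    (φ : α → δ) : Measurable fun p : β × I => φ (sample (w p.1) p.2) := by
  let _ : MeasurableSpace α := ⊤
  have hφ : Measurable φ := measurable_from_top
  refine hφ.comp (measurable_to_countable' fun a => ?_)
  have hc : ∀ a, Measurable fun p : β × I => weightBefore (w p.1) a := fun a =>
    Finset.measurable_sum _ fun b _ => (hm b).comp measurable_fst
  have hd : ∀ a, Measurable fun p : β × I => weightBefore (w p.1) a + w p.1 a := fun a =>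
    (hc a).add ((hm a).comp measurable_fst)
  have hu : Measurable fun p : β × I => (p.2 : ℝ) := measurable_subtype_coe.comp measurable_snd
  have hset : ∀ a, MeasurableSet {p : β × I | weightBefore (w p.1) a ≤ p.2 ∧
      (p.2 : ℝ) < weightBefore (w p.1) a + w p.1 a} := fun a =>
    (measurableSet_le (hc a) hu).inter (measurableSet_lt hu (hd a))
  have : (fun p : β × I => sample (w p.1) p.2) ⁻¹' {a} =
      {p : β × I | weightBefore (w p.1) a ≤ p.2 ∧
        (p.2 : ℝ) < weightBefore (w p.1) a + w p.1 a} ∪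
      ({p : β × I | a = default} ∩ ⋂ b, {p : β × I | weightBefore (w p.1) b ≤ p.2 ∧
        (p.2 : ℝ) < weightBefore (w p.1) b + w p.1 b}ᶜ) := by
    ext p
    simp only [mem_preimage, mem_singleton_iff, sample_eq_iff (hw p.1), mem_union, mem_ofPred_eq,
      mem_inter_iff, mem_iInter, mem_compl_iff]
  rw [this]
  exact (hset a).union ((MeasurableSet.const _).inter
    (MeasurableSet.iInter fun b => (hset b).compl))

/-- Inverse transform sampling from a uniform variable has the prescribed distribution. -/
lemma integral_comp_sample {w : α → ℝ} (hw : ∀ a, 0 ≤ w a) (hw1 : ∑ a, w a = 1)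
    (φ : α → ℝ) : ∫ u : I, φ (sample w u) = ∑ a, w a * φ a := by
  classical
  have h01 : ∀ a, weightBefore w a ∈ Icc (0 : ℝ) 1 ∧ weightBefore w a + w a ∈ Icc (0 : ℝ) 1 := by
    intro a
    have h1 := weightBefore_nonneg hw a
    have h2 := weightBefore_add_le_sum hw a
    have h3 := hw a
    rw [hw1] at h2
    exact ⟨⟨h1, by linarith⟩, ⟨by linarith, h2⟩⟩
  let s : α → Set I := fun a => Ico ⟨_, (h01 a).1⟩ ⟨_, (h01 a).2⟩
  have hs : ∀ a u, u ∈ s a ↔ weightBefore w a ≤ u ∧ (u : ℝ) < weightBefore w a + w a :=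
    fun a u => Iff.rfl
  have hae : (fun u : I => φ (sample w u)) =ᵐ[volume]
      fun u => ∑ a, (s a).indicator (fun _ => φ a) u := by
    have h1 : ∀ᵐ u : I, u ≠ 1 := by
      simp [ae_iff, measure_singleton]
    filter_upwards [h1] with u hu
    have hu1 : (u : ℝ) < ∑ a, w a := by
      rw [hw1]
      exact lt_of_le_of_ne u.2.2 fun h => hu (Subtype.ext h)
    obtain ⟨a, ha⟩ := exists_mem_sampling_interval u.2.1 hu1
    rw [sample_eq_of_mem hw ha, Finset.sum_eq_single a]
    · rw [indicator_of_mem ((hs a u).2 ha)]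
    · intro b _ hb
      exact indicator_of_notMem (fun h => hb (eq_of_mem_sampling_intervals hw ((hs b u).1 h) ha)) _
    · simp
  rw [integral_congr_ae hae, integral_finsetSum]
  · refine Finset.sum_congr rfl fun a _ => ?_
    rw [integral_indicator_const _ measurableSet_Ico, Measure.real, unitInterval.volume_Ico,
      ENNReal.toReal_ofReal (by simpa using hw a)]
    simp
  · intro a _
    exact (integrable_const _).indicator measurableSet_Ico

end Sample

namespace Model

variable {m n : ℕ} (M : Model m n)

/-! ### The decision of a customer -/

-- keeps unification from unfolding the choice inside `sample`
attribute [local irreducible] sample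

lemma measurable_comp_purchase {δ : Type*} [MeasurableSpace δ] (T : ℝ)
    {π : ℝ → M.State → Finset (Fin n) → ℝ} (hπ0 : ∀ t x S, 0 ≤ π t x S)
    (hπm : ∀ x S, Measurable fun t => π t x S) (φ : Option (Fin n) → δ) (x : M.State) :
    Measurable fun p : ℝ × (ℝ × I × I) => φ (M.purchase T π p.1 x p.2) := by
  let _ : MeasurableSpace (Option (Fin n)) := ⊤
  have hφ : Measurable φ := measurable_from_top
  refine hφ.comp ?_
  unfold purchase
  refine Measurable.ite (measurableSet_le measurable_fst measurable_const) ?_ measurable_const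
  have h1 : Measurable fun p : ℝ × (ℝ × I × I) =>
      (sample (π p.1 x) p.2.2.1 : Finset (Fin n)) :=
    (measurable_comp_sample (w := fun t S => π t x S) (fun t => hπ0 t x) (hπm x) id).comp
      (measurable_fst.prodMk (measurable_fst.comp (measurable_snd.comp measurable_snd)))
  have h2 : Measurable fun q : Finset (Fin n) × I => sample (M.P q.1) q.2 := by
    refine measurable_comp_sample M.P_nonneg (fun j => ?_) (id : Option (Fin n) → Option (Fin n))
    exact Measurable.of_discrete
  exact h2.comp (h1.prodMk (measurable_snd.comp (measurable_snd.comp measurable_snd)))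

/-- Distribution of the purchase of a customer who arrives at time `τ ≤ T`. -/
lemma integral_comp_purchase {T : ℝ}
    {π : ℝ → M.State → Finset (Fin n) → ℝ} {τ : ℝ} (hτ : τ ≤ T) (x : M.State)
    (hπ0 : ∀ S, 0 ≤ π τ x S) (hπ1 : ∑ S, π τ x S = 1) (φ : Option (Fin n) → ℝ) (e : ℝ) :
    ∫ u : I × I, φ (M.purchase T π τ x (e, u)) = ∑ S, π τ x S * ∑ j, M.P S j * φ j := by
  simp only [purchase, if_pos hτ]
  have hm : Measurable fun u : I × I => φ (sample (M.P (sample (π τ x) u.1)) u.2) := by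
    have h1 : Measurable fun u : I => (sample (π τ x) u : Finset (Fin n)) :=
      (measurable_comp_sample (β := Unit) (w := fun _ S => π τ x S) (fun _ => hπ0)
        (fun _ => measurable_const) id).comp (measurable_const (a := ()) |>.prodMk measurable_id)
    have h2 : Measurable fun q : Finset (Fin n) × I => φ (sample (M.P q.1) q.2) := by
      refine measurable_comp_sample M.P_nonneg (fun j => ?_) φ
      exact Measurable.of_discrete
    exact h2.comp ((h1.comp measurable_fst).prodMk measurable_snd)
  have hi : Integrable (fun u : I × I => φ (sample (M.P (sample (π τ x) u.1)) u.2))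
      ((volume : Measure I).prod volume) := by
    refine Integrable.of_bound hm.aestronglyMeasurable (∑ j, ‖φ j‖) (Filter.Eventually.of_forall ?_)
    intro u
    exact Finset.single_le_sum (f := fun j => ‖φ j‖) (fun j _ => norm_nonneg _) (Finset.mem_univ _)
  rw [Measure.volume_eq_prod, integral_prod _ hi]
  simp_rw [fun S => integral_comp_sample (M.P_nonneg S) (M.P_sum S) φ]
  exact integral_comp_sample hπ0 hπ1 fun S => ∑ j, M.P S j * φ j

end Model

/-! ### Compensation at an exponential time -/

section Exponential

lemma integral_expMeasure {r : ℝ} (hr : 0 < r) (f : ℝ → ℝ) :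
    ∫ e, f e ∂expMeasure r = ∫ e in Ioi 0, r * Real.exp (-(r * e)) * f e := by
  have hd : expMeasure r = volume.withDensity (exponentialPDF r) := rfl
  have hm : Measurable (exponentialPDF r) := (measurable_exponentialPDFReal r).ennreal_ofReal
  rw [hd, integral_withDensity_eq_integral_toReal_smul hm
    (Filter.Eventually.of_forall fun _ => ENNReal.ofReal_lt_top),
    ← integral_Ici_eq_integral_Ioi, ← integral_indicator measurableSet_Ici]
  congr 1
  ext e
  by_cases he : 0 ≤ e
  · rw [indicator_of_mem (mem_Ici.2 he), exponentialPDF_of_nonneg he,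
      ENNReal.toReal_ofReal (by positivity), smul_eq_mul]
  · rw [indicator_of_notMem (by simpa using he), exponentialPDF_of_neg (not_le.1 he)]
    simp

lemma expMeasure_Iic {r : ℝ} (hr : 0 < r) {x : ℝ} (hx : 0 ≤ x) :
    expMeasure r (Iic x) = ENNReal.ofReal (1 - Real.exp (-(r * x))) := by
  have := isProbabilityMeasure_expMeasure hr
  rw [← ofReal_cdf, cdf_expMeasure_eq hr, if_pos hx]

/-- If `Ψ' = -λ g` and `Ψ 0 = 0`, then a process that evolves along `Ψ` until the first point of a
Poisson process of rate `λ`, and jumps by `g` if this point comes before `L`, has mean zero. -/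
lemma integral_expMeasure_compensated {r : ℝ} (hr : 0 < r) {L : ℝ} (hL : 0 ≤ L)
    {Ψ g : ℝ → ℝ} (hΨ : ContinuousOn Ψ (Icc 0 L)) (hg : ContinuousOn g (Icc 0 L))
    (hderiv : ∀ e ∈ Ioo 0 L, HasDerivAt Ψ (-(r * g e)) e) (h0 : Ψ 0 = 0) :
    ∫ e, (Ψ (min e L) + if e ≤ L then g e else 0) ∂expMeasure r = 0 := by
  have hexp : Continuous fun e : ℝ => Real.exp (-(r * e)) := by fun_prop
  rw [integral_expMeasure hr, ← Ioc_union_Ioi_eq_Ioi hL]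
  have e1 : EqOn (fun e => r * Real.exp (-(r * e)) * (Ψ (min e L) + if e ≤ L then g e else 0))
      (fun e => r * Real.exp (-(r * e)) * (Ψ e + g e)) (Ioc 0 L) := by
    intro e he
    simp only [min_eq_left he.2, if_pos he.2]
  have e2 : EqOn (fun e => r * Real.exp (-(r * e)) * (Ψ (min e L) + if e ≤ L then g e else 0))
      (fun e => (r * Ψ L) * Real.exp (-r * e)) (Ioi L) := by
    intro e he
    have he' : L < e := he
    simp only [min_eq_right he'.le, if_neg (not_le.2 he'), add_zero, neg_mul]
    ring
  have hc : ContinuousOn (fun e => r * Real.exp (-(r * e)) * (Ψ e + g e)) (Icc 0 L) :=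
    ((continuous_const.mul hexp).continuousOn).mul (hΨ.add hg)
  have i1 : IntegrableOn (fun e => r * Real.exp (-(r * e)) * (Ψ e + g e)) (Ioc 0 L) :=
    (hc.integrableOn_compact isCompact_Icc).mono_set Ioc_subset_Icc_self
  have i2 : IntegrableOn (fun e => (r * Ψ L) * Real.exp (-r * e)) (Ioi L) :=
    (integrableOn_exp_mul_Ioi (neg_lt_zero.2 hr) L).const_mul _
  rw [setIntegral_union (Ioc_disjoint_Ioi le_rfl) measurableSet_Ioi
    (i1.congr_fun e1.symm measurableSet_Ioc) (i2.congr_fun e2.symm measurableSet_Ioi),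
    setIntegral_congr_fun measurableSet_Ioc e1, setIntegral_congr_fun measurableSet_Ioi e2,
    integral_const_mul, integral_exp_mul_Ioi (neg_lt_zero.2 hr),
    ← intervalIntegral.integral_of_le hL,
    intervalIntegral.integral_eq_sub_of_hasDerivAt_of_le (f := fun e => -(Real.exp (-(r * e)) * Ψ e))
      hL ((hexp.continuousOn.mul hΨ).neg)]
  · rw [h0]
    field_simp
    ring_nf
  · intro e he
    have h1 : HasDerivAt (fun e : ℝ => Real.exp (-(r * e))) (Real.exp (-(r * e)) * (-(r * 1))) e :=
      (((hasDerivAt_id e).const_mul r).neg).exp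
    refine ((h1.mul (hderiv e he)).neg).congr_deriv ?_
    ring
  · rw [intervalIntegrable_iff_integrableOn_Ioc_of_le hL]
    exact i1

end Exponential

/-! ### Terminal value problems -/

section ODE

open scoped NNReal

variable {E : Type*} [NormedAddCommGroup E] [NormedSpace ℝ E] [CompleteSpace E]

/-- Global solvability of a terminal value problem whose right-hand side is Lipschitz: in the norm
that weights time `t` by `exp (-(K + 1) (T - t))`, the Picard map is a contraction. -/
lemma exists_terminal_value_solution {T : ℝ} (hT : 0 ≤ T) {F : ℝ → E → E}
    (hF : Continuous fun p : ℝ × E => F p.1 p.2) {K : ℝ≥0} (hK : ∀ t, LipschitzWith K (F t)) :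
    ∃ v : ℝ → E, v T = 0 ∧ ∀ t ∈ Icc 0 T, HasDerivAt v (F t (v t)) t := by
  set L : ℝ := K + 1 with hL
  have hLpos : 0 < L := by positivity
  let f : C(Icc 0 T, E) → ℝ → E := fun w s =>
    F s (Real.exp (L * (T - s)) • w (projIcc 0 T hT s))
  have hf : ∀ w, Continuous (f w) := fun w =>
    hF.comp (continuous_id.prodMk ((by fun_prop : Continuous fun s => Real.exp (L * (T - s))).smul
      (w.continuous.comp continuous_projIcc)))
  have hfi : ∀ w a b, IntervalIntegrable (f w) volume a b := fun w a b =>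
    (hf w).intervalIntegrable a b
  have hprim : ∀ w t, HasDerivAt (fun t => ∫ s in T..t, f w s) (f w t) t := fun w t =>
    intervalIntegral.integral_hasDerivAt_right (hfi w _ _)
      ((hf w).stronglyMeasurableAtFilter _ _) (hf w).continuousAt
  have hprimc : ∀ w, Continuous fun t => ∫ s in T..t, f w s := fun w =>
    continuous_iff_continuousAt.2 fun t => (hprim w t).continuousAt
  let Φ : C(Icc 0 T, E) → C(Icc 0 T, E) := fun w =>
    ⟨fun t => Real.exp (-(L * (T - t))) • ∫ s in T..(t : ℝ), f w s,
      (by fun_prop : Continuous fun t : Icc 0 T => Real.exp (-(L * (T - t)))).smul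
        ((hprimc w).comp continuous_subtype_val)⟩
  have hΦ : ∀ w t, Φ w t = Real.exp (-(L * (T - t))) • ∫ s in T..(t : ℝ), f w s :=
    fun _ _ => rfl
  have hq : (K / (K + 1) : ℝ≥0) < 1 := by
    rw [div_lt_one (by positivity)]
    exact lt_add_one K
  have hcontr : ContractingWith (K / (K + 1)) Φ := by
    refine ⟨hq, LipschitzWith.of_dist_le_mul fun w w' => ?_⟩
    rw [ContinuousMap.dist_le (by positivity)]
    intro t
    rw [hΦ, hΦ, dist_eq_norm, ← smul_sub, ← intervalIntegral.integral_sub (hfi w _ _) (hfi w' _ _),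
      norm_smul, Real.norm_of_nonneg (Real.exp_pos _).le]
    have hpt : ∀ s, ‖f w s - f w' s‖ ≤ K * dist w w' * Real.exp (L * (T - s)) := by
      intro s
      rw [← dist_eq_norm]
      refine ((hK s).dist_le_mul _ _).trans ?_
      rw [dist_smul₀, Real.norm_of_nonneg (Real.exp_pos _).le, mul_comm (Real.exp _), ← mul_assoc]
      gcongr
      exact ContinuousMap.dist_apply_le_dist _
    have hint : ∫ s in (t : ℝ)..T, Real.exp (L * (T - s)) =
        (Real.exp (L * (T - t)) - 1) / L := by
      rw [intervalIntegral.integral_eq_sub_of_hasDerivAt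
        (f := fun s => -(Real.exp (L * (T - s)) / L))]
      · simp
        ring
      · intro s _
        have h1 : HasDerivAt (fun s : ℝ => Real.exp (L * (T - s)))
            (Real.exp (L * (T - s)) * (L * (-1))) s :=
          (((hasDerivAt_id s).const_sub T).const_mul L).exp
        refine ((h1.div_const L).neg).congr_deriv ?_
        field_simp
      · exact (by fun_prop : Continuous fun s => Real.exp (L * (T - s))).intervalIntegrable _ _
    have hle : ‖∫ s in T..(t : ℝ), (f w s - f w' s)‖ ≤
        K * dist w w' * ((Real.exp (L * (T - t)) - 1) / L) := by
      rw [intervalIntegral.integral_symm, norm_neg, ← hint,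
        ← intervalIntegral.integral_const_mul]
      refine intervalIntegral.norm_integral_le_of_norm_le t.2.2
        (Filter.Eventually.of_forall fun s _ => hpt s) ?_
      exact (by fun_prop : Continuous fun s =>
        K * dist w w' * Real.exp (L * (T - s))).intervalIntegrable _ _
    calc Real.exp (-(L * (T - t))) * ‖∫ s in T..(t : ℝ), (f w s - f w' s)‖
        ≤ Real.exp (-(L * (T - t))) * (K * dist w w' * ((Real.exp (L * (T - t)) - 1) / L)) := by
          gcongr
      _ = K * dist w w' / L * (1 - Real.exp (-(L * (T - t)))) := by
          rw [Real.exp_neg]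
          field_simp
      _ ≤ K * dist w w' / L * 1 := by
          gcongr
          linarith [Real.exp_pos (-(L * (T - t)))]
      _ = ((K / (K + 1) : ℝ≥0) : ℝ) * dist w w' := by
          push_cast
          rw [hL]
          ring
  let w := hcontr.fixedPoint
  have hw : Φ w = w := hcontr.fixedPoint_isFixedPt
  refine ⟨fun t => ∫ s in T..t, f w s, by simp, fun t ht => ?_⟩
  refine (hprim w t).congr_deriv ?_
  have h1 : w (projIcc 0 T hT t) = Real.exp (-(L * (T - t))) • ∫ s in T..t, f w s := by
    conv_lhs => rw [← hw]
    rw [hΦ, projIcc_of_mem hT ht]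
  simp only [f]
  rw [h1, smul_smul, ← Real.exp_add, add_neg_cancel, Real.exp_zero, one_smul]

end ODE

namespace Model

variable {m n : ℕ} (M : Model m n)

/-! ### The Hamiltonian as an expected gain -/

section Generator

/-- The inventory after a customer has bought `j` (`none`: nothing). -/
def afterSale (x : M.State) (j : Option (Fin n)) : M.State :=
  M.inventory x (j.elim 0 fun j => Pi.single j 1)

/-- Price of the purchase `j` plus the change of the value `w` of the inventory it causes. -/
def saleGain (w : M.State → ℝ) (x : M.State) (j : Option (Fin n)) : ℝ :=
  j.elim 0 M.p + (w (M.afterSale x j) - w x)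

/-- Expected gain, with respect to the value function `w`, from a customer who arrives when the
inventory is `x` and who is offered an assortment drawn from the weights `ϖ`. -/
def expectedGain (ϖ : Finset (Fin n) → ℝ) (w : M.State → ℝ) (x : M.State) : ℝ :=
  ∑ S, ϖ S * ∑ j, M.P S j * M.saleGain w x j

lemma inventory_zero (x : M.State) : M.inventory x 0 = x := by
  apply Subtype.ext
  simp [inventory]

@[simp] lemma afterSale_none (x : M.State) : M.afterSale x none = x := M.inventory_zero x

@[simp] lemma saleGain_none (w : M.State → ℝ) (x : M.State) : M.saleGain w x none = 0 := by
  simp [saleGain]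

lemma inventory_add (x : M.State) (N N' : Fin n → ℕ) :
    M.inventory x (N + N') = M.inventory (M.inventory x N) N' := by
  apply Subtype.ext
  simp only [inventory, Matrix.mulVec_add]
  exact tsub_add_eq_tsub_tsub _ _ _

lemma afterSale_some_apply (x : M.State) (j : Fin n) (i : Fin m) :
    (M.afterSale x (some j)).1 i = x.1 i - M.A i j := by
  simp [afterSale, inventory]

lemma sum_P_some (S : Finset (Fin n)) : ∑ j, M.P S (some j) = 1 - M.P S none := by
  have := M.P_sum S
  rw [Fintype.sum_option] at this
  linarith

/-- Because no product has a zero column, a sale always changes the inventory, and the diagonal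
rate `q(x ∣ x)` balances the rates of all sales. -/
lemma q_eq_sum (hA : ∀ j, ∃ i, M.A i j ≠ 0) (y x : M.State) (S : Finset (Fin n)) :
    M.q y x S = ∑ j, ((if ∀ i, y.1 i + M.A i j = x.1 i then M.lam * M.P S (some j) else 0) -
      if y = x then M.lam * M.P S (some j) else 0) := by
  unfold q
  split_ifs with h
  · subst h
    rw [← M.sum_P_some, Finset.mul_sum, ← Finset.sum_neg_distrib]
    refine Finset.sum_congr rfl fun j _ => ?_
    rw [if_neg, zero_sub]
    intro hj
    obtain ⟨i, hi⟩ := hA j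
    have := hj i
    omega
  · simp only [sub_zero]
    rw [Finset.sum_filter]

lemma sum_mul_q (hA : ∀ j, ∃ i, M.A i j ≠ 0) {x : M.State} {S : Finset (Fin n)}
    (hS : S ∈ M.feasible x) (w : M.State → ℝ) :
    ∑ y, w y * M.q y x S =
      ∑ j, M.lam * M.P S (some j) * (w (M.afterSale x (some j)) - w x) := by
  simp_rw [M.q_eq_sum hA, Finset.mul_sum]
  rw [Finset.sum_comm]
  refine Finset.sum_congr rfl fun j _ => ?_
  by_cases hj : j ∈ S
  · have hx : ∀ i, M.A i j ≤ x.1 i := (Finset.mem_filter.1 hS).2 j hj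
    have hiff : ∀ y : M.State, (∀ i, y.1 i + M.A i j = x.1 i) ↔ y = M.afterSale x (some j) := by
      intro y
      constructor
      · intro h
        apply Subtype.ext
        funext i
        rw [M.afterSale_some_apply, ← h i, Nat.add_sub_cancel]
      · rintro rfl i
        rw [M.afterSale_some_apply, Nat.sub_add_cancel (hx i)]
    simp only [hiff, mul_sub, Finset.sum_sub_distrib, mul_ite, mul_zero, Finset.sum_ite_eq',
      Finset.mem_univ, if_true]
    ring
  · simp [M.P_eq_zero S j hj]

lemma hamiltonian_eq (hA : ∀ j, ∃ i, M.A i j ≠ 0) {x : M.State} {S : Finset (Fin n)}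
    (hS : S ∈ M.feasible x) (t : ℝ) (v : ℝ → M.State → ℝ) :
    M.hamiltonian t x S v = M.lam * ∑ j, M.P S j * M.saleGain (v t) x j := by
  rw [hamiltonian, M.sum_mul_q hA hS, r, Fintype.sum_option, M.saleGain_none, mul_zero, zero_add,
    Finset.mul_sum, Finset.mul_sum, ← Finset.sum_add_distrib]
  refine Finset.sum_congr rfl fun j _ => ?_
  simp only [saleGain, Option.elim_some]
  ring

/-- The Hamiltonian averaged over the policy is the arrival rate times the expected gain. -/
lemma sum_hamiltonian_mul (hA : ∀ j, ∃ i, M.A i j ≠ 0) {x : M.State}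
    {ϖ : Finset (Fin n) → ℝ} (hϖ : ∀ S ∉ M.feasible x, ϖ S = 0) (t : ℝ) (v : ℝ → M.State → ℝ) :
    ∑ S ∈ M.feasible x, M.hamiltonian t x S v * ϖ S = M.lam * M.expectedGain ϖ (v t) x := by
  rw [expectedGain, Finset.mul_sum]
  rw [← Finset.sum_subset (Finset.subset_univ (M.feasible x))]
  · refine Finset.sum_congr rfl fun S hS => ?_
    rw [M.hamiltonian_eq hA hS]
    ring
  · intro S _ hS
    rw [hϖ S hS, zero_mul, mul_zero]

end Generator

end Model

/-! ### Chains driven by independent data -/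

section Recursion

variable {D ζ : Type*} [MeasurableSpace D] [MeasurableSpace ζ] {Z : ℕ → (ℕ → D) → ζ}
  {step : ζ × D → ζ} {z : ζ}

/-- The chain after `k` steps is a function of the data numbered `0, …, k - 1`. -/
lemma measurable_recursion_iSup (hstep : Measurable step) (h0 : ∀ ω, Z 0 ω = z)
    (hs : ∀ k ω, Z (k + 1) ω = step (Z k ω, ω k)) (k : ℕ) :
    Measurable[⨆ i ∈ Iio k, MeasurableSpace.comap (fun ω : ℕ → D => ω i) inferInstance] (Z k) := by
  induction k with
  | zero =>
    rw [show Z 0 = fun _ => z from funext h0]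
    exact measurable_const
  | succ k ih =>
    rw [show Z (k + 1) = fun ω => step (Z k ω, ω k) from funext (hs k)]
    refine hstep.comp (Measurable.prodMk (ih.mono ?_ le_rfl) ?_)
    · exact biSup_mono fun i (hi : i < k) => Nat.lt_succ_of_lt hi
    · refine Measurable.mono (comap_measurable fun ω : ℕ → D => ω k) ?_ le_rfl
      exact le_biSup (fun i => MeasurableSpace.comap (fun ω : ℕ → D => ω i) inferInstance)
        (show k ∈ Iio (k + 1) from Nat.lt_succ_self k)

lemma measurable_recursion (hstep : Measurable step) (h0 : ∀ ω, Z 0 ω = z)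
    (hs : ∀ k ω, Z (k + 1) ω = step (Z k ω, ω k)) (k : ℕ) : Measurable (Z k) :=
  (measurable_recursion_iSup hstep h0 hs k).mono
    (iSup₂_le fun i _ => (measurable_pi_apply i).comap_le) le_rfl

/-- A chain driven by independent data is at each step independent of the next datum. -/
lemma map_recursion_prodMk {μ : Measure D} [IsProbabilityMeasure μ] (hstep : Measurable step)
    (h0 : ∀ ω, Z 0 ω = z) (hs : ∀ k ω, Z (k + 1) ω = step (Z k ω, ω k)) (k : ℕ) :
    (Measure.infinitePi fun _ : ℕ => μ).map (fun ω => (Z k ω, ω k)) =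
      ((Measure.infinitePi fun _ : ℕ => μ).map (Z k)).prod μ := by
  have hind : IndepFun (Z k) (fun ω : ℕ → D => ω k) (Measure.infinitePi fun _ : ℕ => μ) := by
    have h1 : iIndepFun (fun (i : ℕ) (ω : ℕ → D) => ω i) (Measure.infinitePi fun _ : ℕ => μ) :=
      iIndepFun_infinitePi (X := fun _ ω => ω) fun _ => measurable_id
    have h2 := indep_iSup_of_disjoint (fun i => (measurable_pi_apply i).comap_le) h1
      (S := Iio k) (T := {k}) (by simp)
    rw [IndepFun_iff_Indep]
    refine indep_of_indep_of_le_left (indep_of_indep_of_le_right h2 ?_) ?_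
    · exact le_biSup (fun i => MeasurableSpace.comap (fun ω : ℕ → D => ω i) inferInstance)
        (mem_singleton k)
    · exact (measurable_recursion_iSup hstep h0 hs k).comap_le
  rw [hind.map_prod_eq_prod_map_map (measurable_recursion hstep h0 hs k).aemeasurable
    (measurable_pi_apply k).aemeasurable, Measure.infinitePi_map_eval (fun _ : ℕ => μ) k]

end Recursion

namespace Model

variable {m n : ℕ} (M : Model m n)

/-! ### The embedded chain -/

/-- Distribution of the data of one customer. -/
abbrev customerLaw : Measure (ℝ × I × I) :=
  (expMeasure M.lam).prod ((volume : Measure I).prod (volume : Measure I))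

instance : IsProbabilityMeasure M.law :=
  inferInstanceAs (IsProbabilityMeasure (Measure.infinitePi fun _ : ℕ => M.customerLaw))

lemma ae_pos_interarrival : ∀ᵐ d ∂M.customerLaw, 0 < d.1 := by
  have h : ∀ᵐ e ∂expMeasure M.lam, 0 < e := by
    rw [ae_iff]
    have : {e : ℝ | ¬ 0 < e} = Iic 0 := by
      ext e
      simp
    rw [this, expMeasure_Iic M.lam_pos le_rfl]
    simp
  exact Measure.quasiMeasurePreserving_fst.ae h

lemma ae_forall_pos_interarrival : ∀ᵐ ω ∂M.law, ∀ k, 0 < (ω k).1 := by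
  rw [ae_all_iff]
  intro k
  exact (measurePreserving_eval_infinitePi (fun _ : ℕ => M.customerLaw) k).quasiMeasurePreserving.ae
    M.ae_pos_interarrival

/-- Time, and inventory at this time, when `k` customers have been served (`k = 0`: at the
start). -/
def chain (T : ℝ) (π : ℝ → M.State → Finset (Fin n) → ℝ) (t : ℝ) (x : M.State) (k : ℕ)
    (ω : Path) : ℝ × M.State :=
  (t + ∑ i ∈ Finset.range k, (ω i).1, M.inventory x (M.salesAfter T π t x ω k))

/-- Purchase of a customer with data `d`, when the preceding customer left the chain in `z`. -/
def nextPurchase (T : ℝ) (π : ℝ → M.State → Finset (Fin n) → ℝ)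
    (p : (ℝ × M.State) × (ℝ × I × I)) : Option (Fin n) :=
  M.purchase T π (p.1.1 + p.2.1) p.1.2 p.2

/-- One transition of the chain. -/
def chainStep (T : ℝ) (π : ℝ → M.State → Finset (Fin n) → ℝ)
    (p : (ℝ × M.State) × (ℝ × I × I)) : ℝ × M.State :=
  (p.1.1 + p.2.1, M.afterSale p.1.2 (M.nextPurchase T π p))

/-- Reward in one transition: the price of the purchase, and the reward at rate `∂u/∂t` that
accrues over the interarrival time. -/
def stepReward (T : ℝ) (π : ℝ → M.State → Finset (Fin n) → ℝ) (u : ℝ → M.State → ℝ)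
    (p : (ℝ × M.State) × (ℝ × I × I)) : ℝ :=
  (M.nextPurchase T π p).elim 0 M.p + (u (p.1.1 + p.2.1) p.1.2 - u p.1.1 p.1.2)

section Chain

variable {T : ℝ} {π : ℝ → M.State → Finset (Fin n) → ℝ} {t : ℝ} {x : M.State}

lemma chain_zero (ω : Path) : M.chain T π t x 0 ω = (t, x) := by
  simp [chain, salesAfter, inventory_zero]

lemma chain_succ (k : ℕ) (ω : Path) :
    M.chain T π t x (k + 1) ω = M.chainStep T π (M.chain T π t x k ω, ω k) := by
  simp only [chain, chainStep, nextPurchase, salesAfter, inventory_add, afterSale, arrivalTime,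
    Finset.sum_range_succ, add_assoc]

lemma chain_fst (k : ℕ) (ω : Path) :
    (M.chain T π t x k ω).1 = t + ∑ i ∈ Finset.range k, (ω i).1 := rfl

lemma nextPurchase_of_lt {p : (ℝ × M.State) × (ℝ × I × I)} (h : T < p.1.1 + p.2.1) :
    M.nextPurchase T π p = none := by
  rw [nextPurchase, purchase, if_neg (not_le.2 h)]

lemma measurable_uncurry_state {δ : Type*} [MeasurableSpace δ] {f : ℝ → M.State → δ}
    (hf : ∀ x, Measurable fun t => f t x) : Measurable fun p : ℝ × M.State => f p.1 p.2 :=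
  measurable_from_prod_countable_left hf

lemma measurable_comp_nextPurchase {δ : Type*} [MeasurableSpace δ]
    (hπ0 : ∀ t x S, 0 ≤ π t x S) (hπm : ∀ x S, Measurable fun t => π t x S)
    (φ : M.State → Option (Fin n) → δ) :
    Measurable fun p : (ℝ × M.State) × (ℝ × I × I) => φ p.1.2 (M.nextPurchase T π p) := by
  have h : Measurable fun q : (ℝ × (ℝ × I × I)) × M.State =>
      φ q.2 (M.purchase T π q.1.1 q.2 q.1.2) :=
    measurable_from_prod_countable_left fun x => M.measurable_comp_purchase T hπ0 hπm (φ x) x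
  exact h.comp (((((measurable_fst.comp measurable_fst).add
    (measurable_fst.comp measurable_snd)).prodMk measurable_snd)).prodMk
      (measurable_snd.comp measurable_fst))

lemma measurable_chainStep (hπ0 : ∀ t x S, 0 ≤ π t x S)
    (hπm : ∀ x S, Measurable fun t => π t x S) : Measurable (M.chainStep T π) :=
  ((measurable_fst.comp measurable_fst).add (measurable_fst.comp measurable_snd)).prodMk
    (M.measurable_comp_nextPurchase hπ0 hπm fun x j => M.afterSale x j)

lemma measurable_stepReward (hπ0 : ∀ t x S, 0 ≤ π t x S)
    (hπm : ∀ x S, Measurable fun t => π t x S) {u : ℝ → M.State → ℝ}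
    (hu : ∀ x, Measurable fun t => u t x) : Measurable (M.stepReward T π u) := by
  have hu' := M.measurable_uncurry_state hu
  refine (M.measurable_comp_nextPurchase hπ0 hπm fun _ j => j.elim 0 M.p).add (Measurable.sub ?_ ?_)
  · exact hu'.comp (((measurable_fst.comp measurable_fst).add
      (measurable_fst.comp measurable_snd)).prodMk (measurable_snd.comp measurable_fst))
  · exact hu'.comp measurable_fst

lemma measurable_chain (hπ0 : ∀ t x S, 0 ≤ π t x S)
    (hπm : ∀ x S, Measurable fun t => π t x S) (k : ℕ) : Measurable (M.chain T π t x k) :=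
  measurable_recursion (M.measurable_chainStep hπ0 hπm) M.chain_zero M.chain_succ k

/-- A function that has mean zero over the data of the next customer, given any time and
inventory, has mean zero along the chain. -/
lemma integral_chain_eq_zero (hπ0 : ∀ t x S, 0 ≤ π t x S)
    (hπm : ∀ x S, Measurable fun t => π t x S) (ht : 0 ≤ t) (k : ℕ)
    {h : (ℝ × M.State) × (ℝ × I × I) → ℝ} (hm : Measurable h) {C : ℝ} (hC : ∀ p, |h p| ≤ C)
    (h0 : ∀ τ x, 0 ≤ τ → ∫ d, h ((τ, x), d) ∂M.customerLaw = 0) :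
    ∫ ω, h (M.chain T π t x k ω, ω k) ∂M.law = 0 := by
  have hZ := M.measurable_chain (T := T) (t := t) (x := x) hπ0 hπm k
  have hpair : Measurable fun ω : Path => (M.chain T π t x k ω, ω k) :=
    hZ.prodMk (measurable_pi_apply k)
  have hmap : M.law.map (fun ω => (M.chain T π t x k ω, ω k)) =
      (M.law.map (M.chain T π t x k)).prod M.customerLaw :=
    map_recursion_prodMk (M.measurable_chainStep hπ0 hπm) M.chain_zero M.chain_succ k
  have : IsProbabilityMeasure (M.law.map (M.chain T π t x k)) :=
    Measure.isProbabilityMeasure_map hZ.aemeasurable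
  rw [← integral_map hpair.aemeasurable hm.aestronglyMeasurable, hmap,
    integral_prod _ (Integrable.of_bound hm.aestronglyMeasurable C
      (Filter.Eventually.of_forall hC)), integral_map hZ.aemeasurable
      hm.stronglyMeasurable.integral_prod_right'.aestronglyMeasurable]
  refine integral_eq_zero_of_ae ?_
  filter_upwards [M.ae_forall_pos_interarrival] with ω hω
  refine h0 _ _ ?_
  exact add_nonneg ht (Finset.sum_nonneg fun i _ => (hω i).le)

lemma one_sub_exp_mem_Ico (hT : 0 ≤ T) : 1 - Real.exp (-(M.lam * T)) ∈ Ico (0 : ℝ) 1 := by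
  have : Real.exp (-(M.lam * T)) ≤ 1 :=
    Real.exp_le_one_iff.2 (neg_nonpos.2 (mul_nonneg M.lam_pos.le hT))
  have := Real.exp_pos (-(M.lam * T))
  constructor <;> linarith

/-- The number of customers before time `T` has geometric tails. -/
lemma measureReal_chain_fst_le (ht : 0 ≤ t) (hT : 0 ≤ T) (k : ℕ) :
    M.law.real {ω | (M.chain T π t x k ω).1 ≤ T} ≤ (1 - Real.exp (-(M.lam * T))) ^ k := by
  have h1 : M.law {ω | (M.chain T π t x k ω).1 ≤ T} ≤
      M.law (Set.pi (Finset.range k : Set ℕ) fun _ => {d | d.1 ≤ T}) := by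
    refine measure_mono_ae ?_
    filter_upwards [M.ae_forall_pos_interarrival] with ω hω (h : _ ≤ T)
    intro i hi
    rw [chain_fst] at h
    have := Finset.single_le_sum (f := fun i => (ω i).1) (fun i _ => (hω i).le) hi
    show (ω i).1 ≤ T
    linarith
  have h2 : M.customerLaw {d | d.1 ≤ T} = ENNReal.ofReal (1 - Real.exp (-(M.lam * T))) := by
    rw [← expMeasure_Iic M.lam_pos hT, show {d : ℝ × I × I | d.1 ≤ T} = Iic T ×ˢ univ by ext; simp,
      Measure.prod_prod, measure_univ, mul_one]
  have h3 := (M.one_sub_exp_mem_Ico hT).1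
  have h4 : M.law (Set.pi (Finset.range k : Set ℕ) fun _ => {d | d.1 ≤ T}) =
      ENNReal.ofReal ((1 - Real.exp (-(M.lam * T))) ^ k) := by
    rw [law, Measure.infinitePi_pi, Finset.prod_const, h2, Finset.card_range,
      ENNReal.ofReal_pow h3]
    exact fun _ _ => measurableSet_le measurable_fst measurable_const
  rw [h4] at h1
  exact ENNReal.toReal_le_of_le_ofReal (pow_nonneg h3 k) h1

lemma ae_exists_lt_chain_fst (ht : 0 ≤ t) (hT : 0 ≤ T) :
    ∀ᵐ ω ∂M.law, ∃ k, T < t + ∑ i ∈ Finset.range k, (ω i).1 := by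
  rw [ae_iff]
  push Not
  have hle : ∀ k, M.law.real {ω : Path | ∀ k, t + ∑ i ∈ Finset.range k, (ω i).1 ≤ T} ≤
      (1 - Real.exp (-(M.lam * T))) ^ k := by
    intro k
    refine le_trans (measureReal_mono fun ω hω => ?_)
      (M.measureReal_chain_fst_le (π := fun _ _ _ => 0) (x := ⟨M.c, mem_Iic.2 le_rfl⟩) ht hT k)
    exact hω k
  have h0 := ge_of_tendsto' (tendsto_pow_atTop_nhds_zero_of_lt_one (M.one_sub_exp_mem_Ico hT).1
    (M.one_sub_exp_mem_Ico hT).2) hle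
  exact (measureReal_eq_zero_iff).1 (le_antisymm h0 measureReal_nonneg)

end Chain

/-! ### Dynkin's formula along the chain -/

section Dynkin

variable {T : ℝ} {π : ℝ → M.State → Finset (Fin n) → ℝ} {t : ℝ} {x : M.State}
  {u v : ℝ → M.State → ℝ} {C C' : ℝ}

/-- The reward of one transition plus the change of `v`. -/
def increment (T : ℝ) (π : ℝ → M.State → Finset (Fin n) → ℝ) (u v : ℝ → M.State → ℝ)
    (p : (ℝ × M.State) × (ℝ × I × I)) : ℝ :=
  M.stepReward T π u p + (v (M.chainStep T π p).1 (M.chainStep T π p).2 - v p.1.1 p.1.2)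

lemma increment_eq (p : (ℝ × M.State) × (ℝ × I × I)) :
    M.increment T π u v p =
      M.saleGain (v (p.1.1 + p.2.1)) p.1.2 (M.nextPurchase T π p) +
      ((v (p.1.1 + p.2.1) p.1.2 + u (p.1.1 + p.2.1) p.1.2) - (v p.1.1 p.1.2 + u p.1.1 p.1.2)) := by
  simp only [increment, stepReward, chainStep, saleGain]
  ring

lemma abs_elim_price_le (j : Option (Fin n)) : |j.elim 0 M.p| ≤ ∑ j, |M.p j| := by
  cases j with
  | none => simpa using Finset.sum_nonneg fun j _ => abs_nonneg (M.p j)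
  | some j =>
    exact Finset.single_le_sum (f := fun j => |M.p j|) (fun j _ => abs_nonneg _)
      (Finset.mem_univ j)

lemma abs_stepReward_le (hu : ∀ τ x, |u τ x| ≤ C) (p : (ℝ × M.State) × (ℝ × I × I)) :
    |M.stepReward T π u p| ≤ ∑ j, |M.p j| + 2 * C := by
  unfold stepReward
  have h1 := M.abs_elim_price_le (M.nextPurchase T π p)
  have h2 := hu (p.1.1 + p.2.1) p.1.2
  have h3 := hu p.1.1 p.1.2
  rw [abs_le] at *
  constructor <;> linarith

lemma abs_increment_le (hu : ∀ τ x, |u τ x| ≤ C) (hv : ∀ τ x, |v τ x| ≤ C')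
    (p : (ℝ × M.State) × (ℝ × I × I)) :
    |M.increment T π u v p| ≤ ∑ j, |M.p j| + 2 * C + 2 * C' := by
  unfold increment
  have h1 := M.abs_stepReward_le (T := T) (π := π) hu p
  have h2 := hv (M.chainStep T π p).1 (M.chainStep T π p).2
  have h3 := hv p.1.1 p.1.2
  rw [abs_le] at *
  constructor <;> linarith

lemma measurable_increment (hπ0 : ∀ t x S, 0 ≤ π t x S)
    (hπm : ∀ x S, Measurable fun t => π t x S)
    (hu : ∀ x, Measurable fun t => u t x) (hv : ∀ x, Measurable fun t => v t x) :
    Measurable (M.increment T π u v) := by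
  have hv' := M.measurable_uncurry_state hv
  exact (M.measurable_stepReward hπ0 hπm hu).add
    ((hv'.comp (M.measurable_chainStep hπ0 hπm)).sub (hv'.comp measurable_fst))

/-- If `∂/∂t (v + u)` is minus the arrival rate times the expected gain from an arrival, then one
transition of the chain changes `v` by minus the reward, on average. -/
lemma integral_increment (hπ0 : ∀ t x S, 0 ≤ π t x S)
    (hπ1 : ∀ t x, ∑ S, π t x S = 1) (hπc : ∀ x S, Continuous fun t => π t x S)
    (hu : ∀ x, Continuous fun t => u t x) (hv : ∀ x, Continuous fun t => v t x)
    (huC : ∀ τ x, |u τ x| ≤ C) (hvC : ∀ τ x, |v τ x| ≤ C')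
    (huT : ∀ τ x, T ≤ τ → u τ x = u T x) (hvT : ∀ τ x, T ≤ τ → v τ x = 0)
    (hderiv : ∀ τ ∈ Ioo 0 T, ∀ x, HasDerivAt (fun τ => v τ x + u τ x)
      (-(M.lam * M.expectedGain (π τ x) (v τ) x)) τ)
    {τ : ℝ} (hτ : 0 ≤ τ) (x : M.State) :
    ∫ d, M.increment T π u v ((τ, x), d) ∂M.customerLaw = 0 := by
  rcases le_or_gt T τ with hTτ | hτT
  · refine integral_eq_zero_of_ae ?_
    filter_upwards [M.ae_pos_interarrival] with d hd
    have h1 : T < τ + d.1 := by linarith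
    rw [increment_eq, M.nextPurchase_of_lt h1, saleGain_none]
    simp only [huT τ x hTτ, huT _ x h1.le, hvT τ x hTτ, hvT _ x h1.le]
    simp
  have hm : Measurable fun d => M.increment T π u v ((τ, x), d) :=
    (M.measurable_increment hπ0 (fun x S => (hπc x S).measurable) (fun x => (hu x).measurable)
      fun x => (hv x).measurable).comp measurable_prodMk_left
  rw [integral_prod _ (Integrable.of_bound hm.aestronglyMeasurable _
    (Filter.Eventually.of_forall fun d => M.abs_increment_le huC hvC _))]
  set g : ℝ → ℝ := fun e => M.expectedGain (π (τ + e) x) (v (τ + e)) x with hg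
  set Ψ : ℝ → ℝ := fun e => (v (τ + e) x + u (τ + e) x) - (v τ x + u τ x) with hΨ
  have hgc : Continuous g := by
    have h1 : ∀ y, Continuous fun e => v (τ + e) y := fun y =>
      (hv y).comp (continuous_const.add continuous_id)
    have h2 : ∀ S, Continuous fun e => π (τ + e) x S := fun S =>
      (hπc x S).comp (continuous_const.add continuous_id)
    refine continuous_finsetSum _ fun S _ => (h2 S).mul (continuous_finsetSum _ fun j _ => ?_)
    exact continuous_const.mul (continuous_const.add ((h1 _).sub (h1 _)))
  have hΨc : Continuous Ψ := (((hv x).comp (continuous_const.add continuous_id)).add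
    ((hu x).comp (continuous_const.add continuous_id))).sub continuous_const
  -- after the end of the horizon there is no sale, and `v + u` keeps its value at time `T`
  have hinner : ∀ e, ∫ y : I × I, M.increment T π u v ((τ, x), (e, y)) =
      Ψ (min e (T - τ)) + if e ≤ T - τ then g e else 0 := by
    intro e
    simp only [increment_eq]
    split_ifs with he
    · have h1 := M.integral_comp_purchase (T := T) (τ := τ + e) (by linarith) x (hπ0 _ x) (hπ1 _ x)
        (fun j => M.saleGain (v (τ + e)) x j + Ψ e) e
      refine h1.trans ?_
      simp only [mul_add, Finset.sum_add_distrib, ← Finset.sum_mul, M.P_sum, hπ1, one_mul,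
        min_eq_left he]
      rw [add_comm]
      rfl
    · have h1 : T < τ + e := by linarith
      have h2 : ∀ y : I × I, M.nextPurchase T π ((τ, x), (e, y)) = none := fun y =>
        M.nextPurchase_of_lt h1
      simp only [h2, saleGain_none, zero_add, add_zero, integral_const, probReal_univ, one_smul]
      rw [min_eq_right (by linarith), hΨ]
      simp only [add_sub_cancel, huT _ x h1.le, hvT _ x h1.le, hvT T x le_rfl]
  refine (integral_congr_ae (Filter.Eventually.of_forall hinner)).trans ?_
  refine integral_expMeasure_compensated M.lam_pos (by linarith) hΨc.continuousOn
    hgc.continuousOn ?_ (by simp [hΨ])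
  intro e he
  have h1 := (hderiv (τ + e) ⟨by linarith [he.1], by linarith [he.2]⟩ x).comp_const_add τ e
  exact h1.sub_const _

/-- Dynkin's formula for the chain, summed over all customers. -/
lemma integral_tsum_stepReward (hT : 0 ≤ T) (hπ0 : ∀ t x S, 0 ≤ π t x S)
    (hπ1 : ∀ t x, ∑ S, π t x S = 1) (hπc : ∀ x S, Continuous fun t => π t x S)
    (hu : ∀ x, Continuous fun t => u t x) (hv : ∀ x, Continuous fun t => v t x)
    (huC : ∀ τ x, |u τ x| ≤ C) (hvC : ∀ τ x, |v τ x| ≤ C')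
    (huT : ∀ τ x, T ≤ τ → u τ x = u T x) (hvT : ∀ τ x, T ≤ τ → v τ x = 0)
    (hderiv : ∀ τ ∈ Ioo 0 T, ∀ x, HasDerivAt (fun τ => v τ x + u τ x)
      (-(M.lam * M.expectedGain (π τ x) (v τ) x)) τ)
    (ht : 0 ≤ t) (x : M.State) :
    ∫ ω, ∑' k, M.stepReward T π u (M.chain T π t x k ω, ω k) ∂M.law = v t x := by
  set θ := 1 - Real.exp (-(M.lam * T)) with hθ
  have hθ' : θ ∈ Ico (0 : ℝ) 1 := M.one_sub_exp_mem_Ico hT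
  have hπm : ∀ x S, Measurable fun t => π t x S := fun x S => (hπc x S).measurable
  have hZ : ∀ k, Measurable (M.chain T π t x k) := fun k => M.measurable_chain hπ0 hπm k
  have hpair : ∀ k, Measurable fun ω : Path => (M.chain T π t x k ω, ω k) := fun k =>
    (hZ k).prodMk (measurable_pi_apply k)
  let R : ℕ → Path → ℝ := fun k ω => M.stepReward T π u (M.chain T π t x k ω, ω k)
  let V : ℕ → Path → ℝ := fun k ω => v (M.chain T π t x k ω).1 (M.chain T π t x k ω).2
  have hRm : ∀ k, Measurable (R k) := fun k =>
    (M.measurable_stepReward hπ0 hπm fun x => (hu x).measurable).comp (hpair k)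
  have hVm : ∀ k, Measurable (V k) := fun k =>
    (M.measurable_uncurry_state fun x => (hv x).measurable).comp (hZ k)
  have hRi : ∀ k, Integrable (R k) M.law := fun k =>
    Integrable.of_bound (hRm k).aestronglyMeasurable _
      (Filter.Eventually.of_forall fun ω => M.abs_stepReward_le huC _)
  have hVi : ∀ k, Integrable (V k) M.law := fun k =>
    Integrable.of_bound (hVm k).aestronglyMeasurable C'
      (Filter.Eventually.of_forall fun ω => hvC _ _)
  have hset : ∀ k, MeasurableSet {ω | (M.chain T π t x k ω).1 ≤ T} := fun k =>
    measurableSet_le (measurable_fst.comp (hZ k)) measurable_const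
  -- applied to the reward and to the value, which vanish once the clock has passed `T`
  have htail : ∀ (k : ℕ) (f : Path → ℝ) (B : ℝ), 0 ≤ B → (∀ᵐ ω ∂M.law, |f ω| ≤ B) →
      (∀ᵐ ω ∂M.law, T < (M.chain T π t x k ω).1 → f ω = 0) →
      ∫ ω, ‖f ω‖ ∂M.law ≤ B * θ ^ k := by
    intro k f B hB hfB hf0
    have h1 : ∫ ω, ‖f ω‖ ∂M.law ≤
        ∫ ω, {ω | (M.chain T π t x k ω).1 ≤ T}.indicator (fun _ => B) ω ∂M.law := by
      refine integral_mono_of_nonneg (Filter.Eventually.of_forall fun _ => norm_nonneg _)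
        ((integrable_const B).indicator (hset k)) ?_
      filter_upwards [hfB, hf0] with ω h2 h3
      by_cases h : (M.chain T π t x k ω).1 ≤ T
      · rw [indicator_of_mem (show ω ∈ {ω | (M.chain T π t x k ω).1 ≤ T} from h)]
        exact h2
      · rw [h3 (not_le.1 h), norm_zero]
        exact indicator_nonneg (fun _ _ => hB) _
    refine h1.trans ?_
    rw [integral_indicator_const _ (hset k), smul_eq_mul, mul_comm]
    exact mul_le_mul_of_nonneg_left (M.measureReal_chain_fst_le ht hT k) hB
  have hB : 0 ≤ ∑ j, |M.p j| + 2 * C :=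
    (abs_nonneg _).trans (M.abs_stepReward_le (T := T) (π := π) huC ((t, x), (0, 0, 0)))
  have hC' : 0 ≤ C' := (abs_nonneg _).trans (hvC t x)
  have hRb : ∀ k, ∫ ω, ‖R k ω‖ ∂M.law ≤ (∑ j, |M.p j| + 2 * C) * θ ^ k := by
    intro k
    refine htail k _ _ hB (Filter.Eventually.of_forall fun ω => M.abs_stepReward_le huC _) ?_
    filter_upwards [M.ae_forall_pos_interarrival] with ω hω hlt
    have h1 : T < (M.chain T π t x k ω).1 + (ω k).1 := by linarith [hω k]
    simp only [R, stepReward]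
    rw [M.nextPurchase_of_lt h1, huT _ _ hlt.le, huT _ _ h1.le]
    simp
  have hVb : ∀ k, ‖∫ ω, V k ω ∂M.law‖ ≤ C' * θ ^ k := fun k =>
    (norm_integral_le_integral_norm _).trans <|
      htail k _ _ hC' (Filter.Eventually.of_forall fun ω => hvC _ _)
        (Filter.Eventually.of_forall fun ω hlt => hvT _ _ hlt.le)
  have hsum : HasSum (fun k => ∫ ω, R k ω ∂M.law) (∫ ω, ∑' k, R k ω ∂M.law) :=
    hasSum_integral_of_summable_integral_norm hRi <|
      Summable.of_nonneg_of_le (fun k => integral_nonneg fun _ => norm_nonneg _) hRb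
        ((summable_geometric_of_lt_one hθ'.1 hθ'.2).mul_left _)
  have hstep : ∀ k, ∫ ω, R k ω ∂M.law = ∫ ω, V k ω ∂M.law - ∫ ω, V (k + 1) ω ∂M.law := by
    intro k
    have h := M.integral_chain_eq_zero (T := T) (x := x) hπ0 hπm ht k
      (M.measurable_increment (T := T) hπ0 hπm (fun x => (hu x).measurable)
        fun x => (hv x).measurable) (fun p => M.abs_increment_le huC hvC p)
      fun τ y hτ => M.integral_increment hπ0 hπ1 hπc hu hv huC hvC huT hvT hderiv hτ y
    have h' : ∀ ω, M.increment T π u v (M.chain T π t x k ω, ω k) =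
        R k ω + (V (k + 1) ω - V k ω) := by
      intro ω
      simp only [increment, R, V, chain_succ]
    simp only [h'] at h
    have h2 := integral_add (hRi k) ((hVi (k + 1)).sub (hVi k))
    have h3 := integral_sub (hVi (k + 1)) (hVi k)
    simp only [Pi.sub_apply] at h2
    linarith
  have hpart : ∀ K, ∑ k ∈ Finset.range K, ∫ ω, R k ω ∂M.law = v t x - ∫ ω, V K ω ∂M.law := by
    intro K
    simp only [hstep]
    rw [Finset.sum_range_sub']
    simp [V, chain_zero]
  have hlim : Filter.Tendsto (fun K => v t x - ∫ ω, V K ω ∂M.law) Filter.atTop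
      (nhds (v t x - 0)) := by
    refine tendsto_const_nhds.sub (squeeze_zero_norm hVb ?_)
    simpa using (tendsto_pow_atTop_nhds_zero_of_lt_one hθ'.1 hθ'.2).const_mul C'
  have hlim' := hsum.tendsto_sum_nat
  simp only [hpart] at hlim'
  simpa using tendsto_nhds_unique hlim' hlim

end Dynkin

/-! ### Rewards along a path -/

section Pathwise

/-- `γ` times the integral over `[0, τ]` of the entropy in the fixed state `x`, with `τ` clamped to
`[0, T]`. -/
def entropyReward (T γ : ℝ) (π : ℝ → M.State → Finset (Fin n) → ℝ) (τ : ℝ) (x : M.State) : ℝ :=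
  γ * ∫ s in (0 : ℝ)..max 0 (min T τ), M.entropy π s x

variable {T γ : ℝ} {π : ℝ → M.State → Finset (Fin n) → ℝ} {t : ℝ} {x : M.State} {ω : Path}

lemma strictMono_clock (hpos : ∀ k, 0 < (ω k).1) :
    StrictMono fun k => t + ∑ i ∈ Finset.range k, (ω i).1 := by
  refine strictMono_nat_of_lt_succ fun k => ?_
  rw [Finset.sum_range_succ]
  linarith [hpos k]

lemma ncard_Iio (k : ℕ) : ({i | i < k} : Set ℕ).ncard = k := by
  have : ({i | i < k} : Set ℕ) = ↑(Finset.range k) := by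
    ext i
    simp
  rw [this, Set.ncard_coe_finset, Finset.card_range]

/-- Between the arrivals of customers `k - 1` and `k`, the inventory is that of the chain. -/
lemma leftState_eq_chain_snd (hpos : ∀ k, 0 < (ω k).1) {k : ℕ} {s : ℝ}
    (h1 : (M.chain T π t x k ω).1 < s) (h2 : s ≤ (M.chain T π t x (k + 1) ω).1) :
    M.leftState T π t x ω s = (M.chain T π t x k ω).2 := by
  have hmono := strictMono_clock (t := t) hpos
  have hset : {i | arrivalTime t ω i < s} = {i | i < k} := by
    ext i
    constructor
    · intro (h : arrivalTime t ω i < s)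
      exact Nat.succ_lt_succ_iff.1 (hmono.lt_iff_lt.1 (h.trans_le h2))
    · intro (h : i < k)
      exact (hmono.monotone (Nat.succ_le_of_lt h)).trans_lt h1
  rw [leftState, hset, ncard_Iio]
  rfl

lemma sum_price_mul_salesAfter (k : ℕ) :
    ∑ j, M.p j * (M.salesAfter T π t x ω k j : ℝ) =
      ∑ i ∈ Finset.range k, (M.nextPurchase T π (M.chain T π t x i ω, ω i)).elim 0 M.p := by
  induction k with
  | zero => simp [salesAfter]
  | succ k ih =>
    rw [Finset.sum_range_succ, ← ih]
    have hp : M.nextPurchase T π (M.chain T π t x k ω, ω k) =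
        M.purchase T π (arrivalTime t ω k)
          (M.inventory x (M.salesAfter T π t x ω k)) (ω k) := by
      simp only [nextPurchase, chain, arrivalTime, Finset.sum_range_succ, add_assoc]
    simp only [salesAfter, ← hp, Pi.add_apply, Nat.cast_add, mul_add, Finset.sum_add_distrib]
    congr 1
    cases M.nextPurchase T π (M.chain T π t x k ω, ω k) with
    | none => simp
    | some j => simp [Pi.single_apply]

/-- The revenue and the entropy collected along a path, sorted by customers. -/
lemma totalReward_eq_tsum (hent : ∀ x, Continuous fun s => M.entropy π s x)
    (ht : t ∈ Icc 0 T) (hpos : ∀ k, 0 < (ω k).1)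
    (hex : ∃ k, T < t + ∑ i ∈ Finset.range k, (ω i).1) :
    (∑ j, M.p j * ((M.sales T π t x ω T j : ℝ) - (M.sales T π t x ω t j : ℝ))) +
        γ * ∫ s in t..T, M.entropy π s (M.leftState T π t x ω s) =
      ∑' k, M.stepReward T π (M.entropyReward T γ π) (M.chain T π t x k ω, ω k) := by
  classical
  set c : ℕ → ℝ := fun k => t + ∑ i ∈ Finset.range k, (ω i).1 with hc
  have hmono : StrictMono c := strictMono_clock hpos
  have hc0 : c 0 = t := by simp [hc]
  have hct : ∀ k, t ≤ c k := fun k => hc0 ▸ hmono.monotone (Nat.zero_le k)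
  have hcs : ∀ k, c (k + 1) = c k + (ω k).1 := fun k => by
    simp only [hc, Finset.sum_range_succ, add_assoc]
  have hex' : ∃ k, T < c (k + 1) := by
    obtain ⟨k, hk⟩ := hex
    exact ⟨k, hk.trans (hmono (Nat.lt_succ_self k))⟩
  -- `K` is the number of customers who arrive before the end
  obtain ⟨K, hK, hKmin⟩ : ∃ K, T < c (K + 1) ∧ ∀ k < K, c (k + 1) ≤ T :=
    ⟨Nat.find hex', Nat.find_spec hex', fun k hk => not_lt.1 (Nat.find_min hex' hk)⟩
  have hsetT : {k | arrivalTime t ω k ≤ T} = {k | k < K} := by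
    ext k
    constructor
    · intro (h : c (k + 1) ≤ T)
      exact Nat.succ_lt_succ_iff.1 (hmono.lt_iff_lt.1 (h.trans_lt hK))
    · exact hKmin k
  have hsett : {k | arrivalTime t ω k ≤ t} = {k | k < 0} := by
    ext k
    constructor
    · intro (h : c (k + 1) ≤ t)
      exact absurd (hmono (Nat.succ_pos k)) (not_lt.2 (hc0.symm ▸ h))
    · exact fun h => absurd h (Nat.not_lt_zero k)
  have hnone : ∀ k, K ≤ k → M.nextPurchase T π (M.chain T π t x k ω, ω k) = none := by
    intro k hk
    refine M.nextPurchase_of_lt ?_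
    show T < c k + (ω k).1
    rw [← hcs]
    exact hK.trans_le (hmono.monotone (Nat.succ_le_succ hk))
  have hrev : ∑ j, M.p j * ((M.sales T π t x ω T j : ℝ) - (M.sales T π t x ω t j : ℝ)) =
      ∑ k ∈ Finset.range (K + 1),
        (M.nextPurchase T π (M.chain T π t x k ω, ω k)).elim 0 M.p := by
    rw [Finset.sum_range_succ, hnone K le_rfl, Option.elim_none, add_zero,
      ← sum_price_mul_salesAfter]
    simp only [sales, hsetT, hsett, ncard_Iio]
    simp [salesAfter]
  set b : ℕ → ℝ := fun k => min T (c k) with hb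
  have hb0 : b 0 = t := by simp only [hb, hc0, min_eq_right ht.2]
  have hbK : b (K + 1) = T := min_eq_left hK.le
  have hbmono : Monotone b := fun i j hij => min_le_min_left T (hmono.monotone hij)
  have hpiece : ∀ k, EqOn (fun s => M.entropy π s (M.leftState T π t x ω s))
      (fun s => M.entropy π s (M.chain T π t x k ω).2) (Ioc (b k) (b (k + 1))) := by
    intro k s hs
    have hsT : s ≤ T := hs.2.trans (min_le_left _ _)
    have h1 : c k < s := (min_lt_iff.1 hs.1).resolve_left (not_lt.2 hsT)
    simp only [M.leftState_eq_chain_snd hpos h1 (hs.2.trans (min_le_right _ _))]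
  have hint : ∀ k, IntervalIntegrable (fun s => M.entropy π s (M.leftState T π t x ω s)) volume
      (b k) (b (k + 1)) := fun k => by
    rw [intervalIntegrable_iff_integrableOn_Ioc_of_le (hbmono (Nat.le_succ k))]
    exact (((hent _).intervalIntegrable _ _).1).congr_fun (hpiece k).symm measurableSet_Ioc
  have hinc : ∀ k, M.entropyReward T γ π (c k + (ω k).1) (M.chain T π t x k ω).2 -
      M.entropyReward T γ π (c k) (M.chain T π t x k ω).2 =
      γ * ∫ s in b k..b (k + 1), M.entropy π s (M.leftState T π t x ω s) := by
    intro k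
    have h0 : ∀ k, max 0 (min T (c k)) = b k := fun k =>
      max_eq_right (le_min (ht.1.trans ht.2) (ht.1.trans (hct k)))
    rw [entropyReward, entropyReward, ← hcs, h0, h0, ← mul_sub,
      intervalIntegral.integral_interval_sub_left ((hent _).intervalIntegrable _ _)
        ((hent _).intervalIntegrable _ _)]
    congr 1
    rw [intervalIntegral.integral_of_le (hbmono (Nat.le_succ k)),
      intervalIntegral.integral_of_le (hbmono (Nat.le_succ k)),
      setIntegral_congr_fun measurableSet_Ioc (hpiece k)]
  rw [tsum_eq_sum (s := Finset.range (K + 1))]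
  · simp only [stepReward, Finset.sum_add_distrib]
    rw [← hrev]
    congr 1
    refine Eq.trans ?_ (Finset.sum_congr rfl fun k _ => (hinc k).symm)
    rw [← Finset.mul_sum, intervalIntegral.sum_integral_adjacent_intervals fun k _ => hint k,
      hb0, hbK]
  · intro k hk
    have hk' : K + 1 ≤ k := by simpa using hk
    have h1 : b k = T := min_eq_left (hK.le.trans (hmono.monotone hk'))
    have h2 : b (k + 1) = T := min_eq_left (hK.le.trans (hmono.monotone (hk'.trans (Nat.le_succ k))))
    have h3 := hinc k
    rw [h1, h2, intervalIntegral.integral_same, mul_zero] at h3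
    rw [stepReward, hnone k (Nat.le_of_succ_le hk'), Option.elim_none, zero_add]
    exact h3

end Pathwise

/-! ### Dependence on the policy outside the horizon -/

section Clamp

variable {T γ : ℝ} {π π' : ℝ → M.State → Finset (Fin n) → ℝ}

lemma purchase_congr (h : ∀ s ∈ Icc 0 T, π s = π' s) {τ : ℝ} (hτ : 0 ≤ τ) (x : M.State)
    (d : ℝ × I × I) : M.purchase T π τ x d = M.purchase T π' τ x d := by
  unfold purchase
  split_ifs with hT
  · rw [h τ ⟨hτ, hT⟩]
  · rfl

lemma salesAfter_congr (h : ∀ s ∈ Icc 0 T, π s = π' s) {t : ℝ} (ht : 0 ≤ t) (x : M.State)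
    {ω : Path} (hpos : ∀ k, 0 < (ω k).1) (k : ℕ) :
    M.salesAfter T π t x ω k = M.salesAfter T π' t x ω k := by
  induction k with
  | zero => rfl
  | succ k ih =>
    have hk : 0 ≤ arrivalTime t ω k := add_nonneg ht (Finset.sum_nonneg fun i _ => (hpos i).le)
    simp only [salesAfter, ih, M.purchase_congr h hk]

/-- The value function depends on the policy only through its restriction to `[0, T]`. -/
lemma valueFunction_congr (h : ∀ s ∈ Icc 0 T, π s = π' s) {t : ℝ} (ht : t ∈ Icc 0 T)
    (x : M.State) : M.valueFunction T γ π t x = M.valueFunction T γ π' t x := by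
  refine integral_congr_ae ?_
  filter_upwards [M.ae_forall_pos_interarrival] with ω hω
  simp only [sales, leftState, M.salesAfter_congr h ht.1 x hω]
  congr 2
  refine intervalIntegral.integral_congr fun s hs => ?_
  rw [uIcc_of_le ht.2] at hs
  simp only [entropy, h s ⟨ht.1.trans hs.1, hs.2⟩]

end Clamp

/-! ### Verification and existence -/

section ValueFunction

variable {T γ : ℝ} {π : ℝ → M.State → Finset (Fin n) → ℝ} {v : ℝ → M.State → ℝ}

lemma continuous_entropy (hπc : ∀ x S, Continuous fun t => π t x S) (x : M.State) :
    Continuous fun t => M.entropy π t x :=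
  (continuous_finsetSum _ fun S _ => Real.continuous_mul_log.comp (hπc x S)).neg

lemma clamp_mem_Icc (hT : 0 ≤ T) (τ : ℝ) : max 0 (min T τ) ∈ Icc 0 T :=
  ⟨le_max_left _ _, max_le hT (min_le_left _ _)⟩

lemma clamp_of_mem {τ : ℝ} (hτ : τ ∈ Icc 0 T) : max 0 (min T τ) = τ := by
  rw [min_eq_right hτ.2, max_eq_right hτ.1]

lemma clamp_of_le (hT : 0 ≤ T) {τ : ℝ} (hτ : T ≤ τ) : max 0 (min T τ) = T := by
  rw [min_eq_left hτ, max_eq_right hT]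

lemma continuous_comp_clamp (hT : 0 ≤ T) {f : ℝ → ℝ} (hf : ContinuousOn f (Icc 0 T)) :
    Continuous fun τ => f (max 0 (min T τ)) :=
  hf.comp_continuous (by fun_prop) (clamp_mem_Icc hT)

lemma exists_abs_comp_clamp_le (hT : 0 ≤ T) {f : ℝ → M.State → ℝ}
    (hf : ∀ x, ContinuousOn (fun t => f t x) (Icc 0 T)) :
    ∃ C, ∀ τ x, |f (max 0 (min T τ)) x| ≤ C := by
  choose C hC using fun x => isCompact_Icc.exists_bound_of_continuousOn (hf x)
  refine ⟨∑ x, |C x|, fun τ x => ?_⟩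
  exact ((hC x _ (clamp_mem_Icc hT τ)).trans (le_abs_self _)).trans
    (Finset.single_le_sum (f := fun x => |C x|) (fun x _ => abs_nonneg _) (Finset.mem_univ x))

/-- Verification: a solution of the backward system is the value function. -/
lemma eq_valueFunction_of_solves (hA : ∀ j, ∃ i, M.A i j ≠ 0) (hT : 0 < T)
    (hπ : M.IsAdmissible T π) (hv : M.IsC10 T v) (hsol : M.SolvesBackwardODE T γ π v)
    {t : ℝ} (ht : t ∈ Icc 0 T) (x : M.State) : v t x = M.valueFunction T γ π t x := by
  -- outside `[0, T]` the policy and `v` are arbitrary: extend their boundary values instead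
  set π' : ℝ → M.State → Finset (Fin n) → ℝ := fun τ => π (max 0 (min T τ)) with hπ'
  set v' : ℝ → M.State → ℝ := fun τ => v (max 0 (min T τ)) with hv'
  set u : ℝ → M.State → ℝ := M.entropyReward T γ π' with hu
  have hππ' : ∀ s ∈ Icc 0 T, π s = π' s := fun s hs => by simp only [hπ', clamp_of_mem hs]
  have hvv' : ∀ s ∈ Icc 0 T, v s = v' s := fun s hs => by simp only [hv', clamp_of_mem hs]
  have hπc : ∀ x S, Continuous fun t => π' t x S := fun x S =>
    continuous_comp_clamp hT.le (hπ.continuousOn x S)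
  have hvc : ∀ x, Continuous fun t => v' t x := fun x =>
    continuous_comp_clamp hT.le (hv x).continuousOn
  have hent := M.continuous_entropy hπc
  have hprim : ∀ x τ, HasDerivAt (fun τ => ∫ s in (0 : ℝ)..τ, M.entropy π' s x)
      (M.entropy π' τ x) τ := fun x τ =>
    intervalIntegral.integral_hasDerivAt_right ((hent x).intervalIntegrable _ _)
      ((hent x).stronglyMeasurableAtFilter _ _) (hent x).continuousAt
  have hUc : ∀ x, Continuous fun τ => γ * ∫ s in (0 : ℝ)..τ, M.entropy π' s x := fun x =>
    continuous_const.mul (continuous_iff_continuousAt.2 fun τ => (hprim x τ).continuousAt)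
  have huc : ∀ x, Continuous fun t => u t x := fun x =>
    continuous_comp_clamp hT.le (hUc x).continuousOn
  obtain ⟨C, hC⟩ := M.exists_abs_comp_clamp_le hT.le fun x => (hUc x).continuousOn
  obtain ⟨C', hC'⟩ := M.exists_abs_comp_clamp_le hT.le fun x => (hv x).continuousOn
  have hderiv : ∀ τ ∈ Ioo 0 T, ∀ x, HasDerivAt (fun τ => v' τ x + u τ x)
      (-(M.lam * M.expectedGain (π' τ x) (v' τ) x)) τ := by
    intro τ hτ x
    have hτ' : τ ∈ Icc 0 T := Ioo_subset_Icc_self hτ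
    have hnhds : Icc 0 T ∈ nhds τ := Icc_mem_nhds hτ.1 hτ.2
    have h1 : HasDerivAt (fun s => v s x) (derivWithin (fun s => v s x) (Icc 0 T) τ) τ :=
      (((hv x).differentiableOn one_ne_zero τ hτ').hasDerivWithinAt).hasDerivAt hnhds
    have h2 := h1.add ((hprim x τ).const_mul γ)
    have h3 := hsol.1 τ ⟨hτ.1.le, hτ.2⟩ x
    rw [M.sum_hamiltonian_mul hA (hπ.eq_zero τ hτ' x)] at h3
    have h4 : M.entropy π τ x = M.entropy π' τ x := by simp only [entropy, hππ' τ hτ']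
    rw [h4] at h3
    rw [← hππ' τ hτ', ← hvv' τ hτ']
    refine (h2.congr_of_eventuallyEq ?_).congr_deriv (by linarith)
    filter_upwards [hnhds] with s hs
    simp only [hv', hu, entropyReward, clamp_of_mem hs]
    rfl
  rw [M.valueFunction_congr hππ' ht, hvv' t ht,
    ← M.integral_tsum_stepReward hT.le (fun τ => hπ.nonneg _ (clamp_mem_Icc hT.le τ))
      (fun τ => hπ.sum_eq_one _ (clamp_mem_Icc hT.le τ)) hπc huc hvc hC hC'
      (fun τ x hτ => by simp only [hu, entropyReward, clamp_of_le hT.le hτ,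
        clamp_of_le hT.le le_rfl])
      (fun τ x hτ => by simp only [hv', clamp_of_le hT.le hτ, hsol.2]) hderiv ht.1 x]
  refine integral_congr_ae ?_
  filter_upwards [M.ae_forall_pos_interarrival, M.ae_exists_lt_chain_fst ht.1 hT.le] with ω h1 h2
  exact (M.totalReward_eq_tsum hent ht h1 h2).symm

lemma abs_expectedGain_sub_le {ϖ : Finset (Fin n) → ℝ} (h0 : ∀ S, 0 ≤ ϖ S)
    (h1 : ∑ S, ϖ S = 1) (w w' : M.State → ℝ) (x : M.State) :
    |M.expectedGain ϖ w x - M.expectedGain ϖ w' x| ≤ 2 * dist w w' := by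
  have hgain : ∀ j, |M.saleGain w x j - M.saleGain w' x j| ≤ 2 * dist w w' := by
    intro j
    have h2 := dist_le_pi_dist w w' (M.afterSale x j)
    have h3 := dist_le_pi_dist w w' x
    rw [Real.dist_eq] at h2 h3
    simp only [saleGain]
    rw [abs_le] at *
    constructor <;> linarith
  calc |M.expectedGain ϖ w x - M.expectedGain ϖ w' x|
      = |∑ S, ϖ S * ∑ j, M.P S j * (M.saleGain w x j - M.saleGain w' x j)| := by
        simp only [expectedGain, mul_sub, Finset.sum_sub_distrib]
    _ ≤ ∑ S, ϖ S * ∑ j, M.P S j * (2 * dist w w') := by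
        refine (Finset.abs_sum_le_sum_abs _ _).trans (Finset.sum_le_sum fun S _ => ?_)
        rw [abs_mul, abs_of_nonneg (h0 S)]
        refine mul_le_mul_of_nonneg_left ?_ (h0 S)
        refine (Finset.abs_sum_le_sum_abs _ _).trans (Finset.sum_le_sum fun j _ => ?_)
        rw [abs_mul, abs_of_nonneg (M.P_nonneg S j)]
        exact mul_le_mul_of_nonneg_left (hgain j) (M.P_nonneg S j)
    _ = 2 * dist w w' := by
        simp only [← Finset.sum_mul, M.P_sum, h1, one_mul]

lemma exists_solvesBackwardODE (hA : ∀ j, ∃ i, M.A i j ≠ 0) (hT : 0 < T) (γ : ℝ)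
    (hπ : M.IsAdmissible T π) : ∃ v, M.IsC10 T v ∧ M.SolvesBackwardODE T γ π v := by
  set π' : ℝ → M.State → Finset (Fin n) → ℝ := fun τ => π (max 0 (min T τ)) with hπ'
  have hππ' : ∀ s ∈ Icc 0 T, π s = π' s := fun s hs => by simp only [hπ', clamp_of_mem hs]
  have hπc : ∀ x S, Continuous fun t => π' t x S := fun x S =>
    continuous_comp_clamp hT.le (hπ.continuousOn x S)
  let F : ℝ → (M.State → ℝ) → M.State → ℝ := fun t w x =>
    -(M.lam * M.expectedGain (π' t x) w x + γ * M.entropy π' t x)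
  have hF : Continuous fun p : ℝ × (M.State → ℝ) => F p.1 p.2 := by
    refine continuous_pi fun x => (Continuous.add (continuous_const.mul ?_)
      (continuous_const.mul ((M.continuous_entropy hπc x).comp continuous_fst))).neg
    refine continuous_finsetSum _ fun S _ => ((hπc x S).comp continuous_fst).mul
      (continuous_finsetSum _ fun j _ => continuous_const.mul (continuous_const.add ?_))
    exact ((continuous_apply _).comp continuous_snd).sub ((continuous_apply _).comp continuous_snd)
  have hK : ∀ t, LipschitzWith (Real.toNNReal (2 * M.lam)) (F t) := by
    intro t
    refine LipschitzWith.of_dist_le_mul fun w w' => ?_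
    rw [Real.coe_toNNReal _ (by linarith [M.lam_pos]), dist_pi_le_iff
      (mul_nonneg (by linarith [M.lam_pos]) dist_nonneg)]
    intro x
    have h := M.abs_expectedGain_sub_le (fun S => hπ.nonneg _ (clamp_mem_Icc hT.le t) x S)
      (hπ.sum_eq_one _ (clamp_mem_Icc hT.le t) x) w w' x
    calc dist (F t w x) (F t w' x)
        = M.lam * |M.expectedGain (π' t x) w x - M.expectedGain (π' t x) w' x| := by
          have hsub : F t w x - F t w' x =
              -(M.lam * (M.expectedGain (π' t x) w x - M.expectedGain (π' t x) w' x)) := by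
            simp only [F]
            ring
          rw [Real.dist_eq, hsub, abs_neg, abs_mul, abs_of_pos M.lam_pos]
      _ ≤ M.lam * (2 * dist w w') := mul_le_mul_of_nonneg_left h M.lam_pos.le
      _ = 2 * M.lam * dist w w' := by ring
  obtain ⟨v, hvT, hv⟩ := exists_terminal_value_solution hT.le hF hK
  have hd : ∀ x, ∀ t ∈ Icc 0 T, HasDerivAt (fun s => v s x) (F t (v t) x) t := fun x t ht =>
    hasDerivAt_pi.1 (hv t ht) x
  have hdw : ∀ x, ∀ t ∈ Icc 0 T, derivWithin (fun s => v s x) (Icc 0 T) t = F t (v t) x :=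
    fun x t ht => (hd x t ht).hasDerivWithinAt.derivWithin (uniqueDiffOn_Icc hT t ht)
  refine ⟨v, fun x => ?_, fun t ht x => ?_, fun x => by rw [hvT]; rfl⟩
  · rw [contDiffOn_one_iff_derivWithin (uniqueDiffOn_Icc hT)]
    refine ⟨fun t ht => (hd x t ht).differentiableAt.differentiableWithinAt, ?_⟩
    refine ContinuousOn.congr ?_ (hdw x)
    have hvc : ContinuousOn v (Icc 0 T) := fun t ht => (hv t ht).continuousAt.continuousWithinAt
    exact (continuous_apply x).comp_continuousOn
      (hF.comp_continuousOn (continuousOn_id.prodMk hvc))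
  · have ht' : t ∈ Icc 0 T := Ico_subset_Icc_self ht
    have h4 : M.entropy π t x = M.entropy π' t x := by simp only [entropy, hππ' t ht']
    rw [hdw x t ht', M.sum_hamiltonian_mul hA (hπ.eq_zero t ht' x), h4, hππ' t ht']
    simp only [F]
    ring

lemma SolvesBackwardODE.congr {w : ℝ → M.State → ℝ} (h : M.SolvesBackwardODE T γ π w)
    (hT : 0 ≤ T) (hvw : ∀ t ∈ Icc 0 T, v t = w t) : M.SolvesBackwardODE T γ π v := by
  refine ⟨fun t ht x => ?_, fun x => by rw [hvw T ⟨hT, le_rfl⟩]; exact h.2 x⟩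
  have ht' : t ∈ Icc 0 T := Ico_subset_Icc_self ht
  rw [derivWithin_congr (fun s hs => congrFun (hvw s hs) x) (congrFun (hvw t ht') x)]
  simp only [hamiltonian, hvw t ht']
  exact h.1 t ht x

end ValueFunction

end Model

end RevenueManagement

end

theorem lemma1 {m n : ℕ} (M : RevenueManagement.Model m n)
    (hA : ∀ j, ∃ i, M.A i j ≠ 0) (T : ℝ) (hT : 0 < T) (γ : ℝ) (hγ : 0 ≤ γ)
    (π : ℝ → M.State → Finset (Fin n) → ℝ) (hπ : M.IsAdmissible T π) :
    (∃ v : ℝ → M.State → ℝ, M.IsC10 T v ∧ M.SolvesBackwardODE T γ π v) ∧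
    ∀ v : ℝ → M.State → ℝ, M.IsC10 T v →
      ((∀ t ∈ Set.Icc 0 T, ∀ x, v t x = M.valueFunction T γ π t x) ↔
        M.SolvesBackwardODE T γ π v) := by
  obtain ⟨w, hw, hwsol⟩ := M.exists_solvesBackwardODE hA hT γ hπ
  refine ⟨⟨w, hw, hwsol⟩, fun v hv => ⟨fun hJ => ?_, fun hsol t ht x => ?_⟩⟩
  · -- `v` agrees on `[0, T]` with the solution `w`, which is the value function as well
    refine RevenueManagement.Model.SolvesBackwardODE.congr M hwsol hT.le
      fun t ht => funext fun x => ?_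
    rw [hJ t ht x, M.eq_valueFunction_of_solves hA hT hπ hw hwsol ht x]
  · exact M.eq_valueFunction_of_solves hA hT hπ hv hsol ht x
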